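/- **Conventions.** In a complete lattice $L$ an element $k$ is compact if $k\le\bigvee S$ implies $k\le\bigvee T$ for some finite $T\subseteq S$; $K(L)$ is the set of compact elements. An algebraic frame is a frame in which every element is a join of compact elements. We write $a\ll b$ if $b\le\bigvee S$ implies $a\le\bigvee T$ for some finite $T\subseteq S$. An element $p\neq 1$ is prime if $a\wedge b\le p$ implies $a\le p$ or $b\le p$, and pseudoprime if $a_1\wedge\dots\wedge a_n\ll p$ implies $a_i\le p$ for some $i$; $P(L)$ and $PP(L)$ are the sets of prime and of pseudoprime elements, and $Y_L=PP(L)\cup\{1\}$. **Frames.** $\mathsf{AlgFrm_J}$ is the category of algebraic frames and maps preserving arbitrary joins and compact elements. $\mathsf{AlgFrm_S}$ is its wide subcategory of those $\alpha:L\to M$ such that $\alpha(\bigwedge S)=\bigwedge\alpha[S]$ whenever $S\subseteq K(L)$ is finite and nonempty and $\bigwedge S\in K(L)$. **Spaces.** For a Priestley space $X$ and $X_0\subseteq X$, a clopen upset $U$ is admissible if all maximal elements of $X\setminus U$ lie in $X_0$; $\mathcal A(X)$ is the set of admissible clopen upsets and $\mathcal I_x=\{U\in\mathcal A(X): x\notin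 U\}$. A pointed generalized Priestley space is a tuple $(X,\tau,\le,X_0,m)$ such that $(X,\tau,\le)$ is a Priestley space, $m$ is its greatest element, $X_0\subseteq X\setminus\{m\}$ is dense in $X\setminus\{m\}$, every $x\ne m$ is below some $y\in X_0$, $x\in X_0$ iff $\mathcal I_x$ is nonempty and directed, and $x\le y$ iff every $U\in\mathcal A(X)$ that contains $x$ contains $y$. For $R\subseteq X\times Y$ put $\Box_RU=\{x: R[x]\subseteq U\}$. A generalized Priestley morphism $X\to Y$ is a relation $R\subseteq X\times Y$ such that (1) if $x\not\mathrel{R}y$, there is $U\in\mathcal A(Y)$ with $R[x]\subseteq U$ and $y\notin U$, and (2) $\Box_RU\in\mathcal A(X)$ for all $U\in\mathcal A(Y)$. These form the category $\mathsf{PGPS}$, where identities are the orders and $x\,(S*R)\,z$ iff every $U\in\mathcal A(Z)$ with $x\in\Box_R\Box_SU$ contains $z$. $\mathsf{PGPS_F}$ is the wide subcategory of functional morphisms: those for which every $R[x]$ has a least element. $\mathsf{PGPS_S}$ has the same objects; its morphisms are the strong Priestley morphisms, i.e. the order-preserving maps $f:X\to Y$ with $f^{-1}(U)\in\mathcal A(X)$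 for all $U\in\mathcal A(Y)$, with ordinary composition. A functional $R$ yields the strong Priestley morphism $x\mapsto\min R[x]$, and a strong Priestley morphism $f$ yields the functional morphism $R_f$, $x\,R_f\,y$ iff $f(x)\le y$. **Functors.** $\mathcal V^a:\mathsf{PGPS}^{op}\to\mathsf{AlgFrm_J}$ sends $X$ to the frame $\mathcal V^a(X)$, ordered by $\supseteq$, of closed upsets $C$ with $X\setminus C={\downarrow}(X_0\setminus C)$, and $R$ to $\Box_R$. $\mathcal Y:\mathsf{AlgFrm_J}\to\mathsf{PGPS}^{op}$ sends $L$ to $Y_L$ with distinguished subset $P(L)$, point $1$, the order of $L$, and the restriction of the topology on $L$ generated by the sets ${\uparrow}k$ and $({\uparrow}k)^c$, $k\in K(L)$; it sends $\alpha:L\to M$ with right adjoint $r$ to $R_\alpha\subseteq Y_M\times Y_L$, $p\,R_\alpha\,q$ iff $r(p)\le q$. **Theorem.** (a) $\mathcal Y$ and $\mathcal V^a$ form a dual equivalence between $\mathsf{AlgFrm_J}$ and $\mathsf{PGPS}$, with natural isomorphisms $\eta:1\to\mathcal V^a\mathcal Y$, $\eta_L(a)={\uparrow}a\cap Y_L$,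 and $\Upsilon:1\to\mathcal Y\mathcal V^a$, $x\,\Upsilon_X\,C$ iff $C\subseteq{\uparrow}x$. (b) This duality restricts to a duality between $\mathsf{AlgFrm_S}$ and $\mathsf{PGPS_F}$: $\mathcal Y$ sends $\mathsf{AlgFrm_S}$-morphisms to functional morphisms, $\mathcal V^a$ sends functional morphisms to $\mathsf{AlgFrm_S}$-morphisms, and $\eta$, $\Upsilon$ restrict to natural isomorphisms for the restricted functors. (c) Replacing functional morphisms by the corresponding strong Priestley morphisms yields a duality between $\mathsf{AlgFrm_S}$ and $\mathsf{PGPS_S}$, with natural isomorphisms $\eta$ and $x\mapsto{\uparrow}x$; its functors send an $\mathsf{AlgFrm_S}$-morphism $\alpha:L\to M$ to the restriction $r:Y_M\to Y_L$ of its right adjoint, and a strong Priestley morphism $f$ to $f^{-1}:\mathcal V^a(Y)\to\mathcal V^a(X)$. -/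

import Mathlib

open CategoryTheory Opposite

universe u

namespace GenPriestley

/-! ### Pointed generalized Priestley spaces -/

/-- `□_R U = {x | R[x] ⊆ U}`. -/
def box {X Y : Type u} (R : X → Y → Prop) (U : Set Y) : Set X := {x | ∀ y, R x y → y ∈ U}

/-- A clopen upset `U` of an ordered space is admissible, with respect to a set `X₀` of points, if
every maximal element of its complement lies in `X₀`. -/
def AdmissibleClopen {X : Type u} [TopologicalSpace X] [PartialOrder X] (X₀ U : Set X) : Prop :=
  IsClopen U ∧ IsUpperSet U ∧ ∀ x, Maximal (fun z => z ∈ Uᶜ) x → x ∈ X₀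

/-- The set `𝓘ₓ` of all admissible clopen upsets that miss `x`. -/
def missing {X : Type u} [TopologicalSpace X] [PartialOrder X] (X₀ : Set X) (x : X) :
    Set (Set X) := {U | AdmissibleClopen X₀ U ∧ x ∉ U}

/-- Pointed generalized Priestley spaces: a Priestley space with a greatest element `m` and a subset
`X₀` that is dense and order-dense in `X \ {m}`, such that `X₀` consists of the points `x` for which
`𝓘ₓ` is nonempty and directed, and such that the admissible clopen upsets determine the order. -/
structure PGPS : Type (u + 1) where
  carrier : Type u
  [topology : TopologicalSpace carrier]
  [order : PartialOrder carrier]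
  [compact : CompactSpace carrier]
  [priestley : PriestleySpace carrier]
  X₀ : Set carrier
  m : carrier
  le_m : ∀ x, x ≤ m
  X₀_subset : X₀ ⊆ {m}ᶜ
  dense : {m}ᶜ ⊆ closure X₀
  order_dense : ∀ x, x ≠ m → ∃ y ∈ X₀, x ≤ y
  mem_X₀_iff : ∀ x, x ∈ X₀ ↔
    (missing X₀ x).Nonempty ∧ DirectedOn (fun U V => U ⊆ V) (missing X₀ x)
  le_iff : ∀ x y, x ≤ y ↔ ∀ U, AdmissibleClopen X₀ U → x ∈ U → y ∈ U

instance : CoeSort PGPS.{u} (Type u) := ⟨PGPS.carrier⟩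

attribute [instance] PGPS.topology PGPS.order PGPS.compact PGPS.priestley

/-- The admissible clopen upsets of a pointed generalized Priestley space. -/
def PGPS.Adm (X : PGPS.{u}) (U : Set X) : Prop := AdmissibleClopen X.X₀ U

/-- Generalized Priestley morphisms: relations `R ⊆ X × Y` such that (1) if not `x R y`, then some
admissible clopen upset of `Y` contains `R[x]` and misses `y`, and (2) `□_R` sends admissible clopen
upsets of `Y` to admissible clopen upsets of `X`. -/
@[ext]
structure GPMor (X Y : PGPS.{u}) where
  rel : X → Y → Prop
  separates : ∀ x y, ¬ rel x y → ∃ U, Y.Adm U ∧ (∀ z, rel x z → z ∈ U) ∧ y ∉ U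
  box_adm : ∀ U, Y.Adm U → X.Adm (box rel U)

theorem PGPS.box_le (X : PGPS.{u}) {U : Set X} (hU : IsUpperSet U) :
    box (fun x y : X => x ≤ y) U = U := by
  ext x
  exact ⟨fun h => h x le_rfl, fun h y hy => hU hy h⟩

/-- The identity morphism is the order. -/
def GPMor.id (X : PGPS.{u}) : GPMor X X where
  rel x y := x ≤ y
  separates x y h := by
    rw [X.le_iff] at h
    push Not at h
    obtain ⟨U, hU, hx, hy⟩ := h
    exact ⟨U, hU, fun z hz => hU.2.1 hz hx, hy⟩
  box_adm U hU := by rw [X.box_le hU.2.1]; exact hU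

/-- The relation `S * R`: `x (S * R) z` iff every admissible clopen upset `U` of `Z` with
`x ∈ □_R □_S U` contains `z`. -/
def starRel {X Y Z : PGPS.{u}} (R : X → Y → Prop) (S : Y → Z → Prop) (x : X) (z : Z) : Prop :=
  ∀ U : Set Z, Z.Adm U → x ∈ box R (box S U) → z ∈ U

theorem box_starRel {X Y Z : PGPS.{u}} (R : X → Y → Prop) (S : Y → Z → Prop) {U : Set Z}
    (hU : Z.Adm U) : box (starRel R S) U = box R (box S U) := by
  ext x
  constructor
  · intro h y hxy t hyt
    exact h t fun W _ hx => hx y hxy t hyt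
  · intro h z hz
    exact hz U hU h

/-- The composition `S * R` of generalized Priestley morphisms (first `R`, then `S`). -/
def GPMor.comp {X Y Z : PGPS.{u}} (R : GPMor X Y) (S : GPMor Y Z) : GPMor X Z where
  rel := starRel R.rel S.rel
  separates x z h := by
    unfold starRel at h
    push Not at h
    obtain ⟨U, hU, hx, hz⟩ := h
    exact ⟨U, hU, fun t ht => ht U hU hx, hz⟩
  box_adm U hU := by
    rw [box_starRel _ _ hU]
    exact R.box_adm _ (S.box_adm _ hU)

/-- A generalized Priestley morphism is determined by `□` on admissible clopen upsets. -/
theorem GPMor.rel_iff {X Y : PGPS.{u}} (R : GPMor X Y) (x : X) (y : Y) :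
    R.rel x y ↔ ∀ U, Y.Adm U → x ∈ box R.rel U → y ∈ U := by
  constructor
  · intro h U _ hx
    exact hx y h
  · intro h
    by_contra hn
    obtain ⟨U, hU, h1, h2⟩ := R.separates x y hn
    exact h2 (h U hU h1)

theorem GPMor.ext_box {X Y : PGPS.{u}} {R S : GPMor X Y}
    (h : ∀ U, Y.Adm U → box R.rel U = box S.rel U) : R = S := by
  apply GPMor.ext
  funext x y
  rw [R.rel_iff, S.rel_iff]
  refine propext ⟨fun H U hU hx => H U hU (by rwa [h U hU]), fun H U hU hx => H U hU ?_⟩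
  rwa [← h U hU]

theorem GPMor.box_comp {X Y Z : PGPS.{u}} (R : GPMor X Y) (S : GPMor Y Z) {U : Set Z}
    (hU : Z.Adm U) : box (R.comp S).rel U = box R.rel (box S.rel U) :=
  box_starRel _ _ hU

/-- `PGPS` with generalized Priestley morphisms. -/
instance : Category PGPS.{u} where
  Hom := GPMor
  id := GPMor.id
  comp R S := R.comp S
  id_comp {X Y} R := GPMor.ext_box fun U hU => by
    rw [GPMor.box_comp _ _ hU]
    exact X.box_le (R.box_adm U hU).2.1
  comp_id {X Y} R := GPMor.ext_box fun U hU => by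
    rw [GPMor.box_comp _ _ hU]
    exact congrArg _ (Y.box_le hU.2.1)
  assoc R S T := GPMor.ext_box fun U hU => by
    rw [GPMor.box_comp _ _ hU, GPMor.box_comp _ _ (T.box_adm U hU), GPMor.box_comp _ _ hU,
      GPMor.box_comp _ _ hU]

/-- `R` is functional if every `R[x]` has a least element. -/
def functional : MorphismProperty PGPS.{u} :=
  fun _ _ R => ∀ x, ∃ y, IsLeast {z | GPMor.rel R x z} y

/-- The least element of `R[x]` for a functional `R`. -/
noncomputable def leastFun {X Y : PGPS.{u}} (R : X ⟶ Y) (h : functional R) (x : X) : Y :=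
  (h x).choose

theorem rel_iff_leastFun_le {X Y : PGPS.{u}} (R : X ⟶ Y) (h : functional R) (x : X) (y : Y) :
    GPMor.rel R x y ↔ leastFun R h x ≤ y := by
  have hl := (h x).choose_spec
  refine ⟨fun hy => hl.2 hy, fun hy => ?_⟩
  rw [GPMor.rel_iff]
  intro U hU hx
  exact hU.2.1 hy (hx _ hl.1)

theorem leastFun_eq {X Y : PGPS.{u}} (R : X ⟶ Y) (h : functional R) (x : X) (y : Y)
    (hy : ∀ z, GPMor.rel R x z ↔ y ≤ z) : leastFun R h x = y := by
  apply le_antisymm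
  · rw [← rel_iff_leastFun_le, hy]
  · rw [← hy, rel_iff_leastFun_le R h]

theorem box_leastFun {X Y : PGPS.{u}} (R : X ⟶ Y) (h : functional R) {U : Set Y}
    (hU : IsUpperSet U) : box (GPMor.rel R) U = leastFun R h ⁻¹' U := by
  ext x
  constructor
  · intro hx
    exact hx _ ((rel_iff_leastFun_le R h _ _).2 le_rfl)
  · intro hx y hy
    exact hU ((rel_iff_leastFun_le R h _ _).1 hy) hx

theorem comp_rel_iff {X Y Z : PGPS.{u}} (R : X ⟶ Y) (S : Y ⟶ Z) (hR : functional R)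
    (hS : functional S) (x : X) (z : Z) :
    GPMor.rel (R ≫ S) x z ↔ leastFun S hS (leastFun R hR x) ≤ z := by
  rw [Z.le_iff]
  refine forall₂_congr fun U hU => ?_
  rw [box_leastFun R hR (S.box_adm U hU).2.1, box_leastFun S hS hU.2.1]
  rfl

instance : functional.{u}.IsMultiplicative where
  id_mem _ := fun x => ⟨x, le_rfl, fun _ hz => hz⟩
  comp_mem R S hR hS := fun x => ⟨leastFun S hS (leastFun R hR x),
    (comp_rel_iff R S hR hS x _).2 le_rfl, fun z hz => (comp_rel_iff R S hR hS x z).1 hz⟩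

/-- The wide subcategory of `PGPS` of functional morphisms. -/
abbrev PGPSF : Type (u + 1) := WideSubcategory functional.{u}

/-- Pointed generalized Priestley spaces, as objects of the category with strong Priestley
morphisms. -/
structure PGPSS : Type (u + 1) where
  toPGPS : PGPS.{u}

/-- Strong Priestley morphisms: order-preserving maps that pull admissible clopen upsets back to
admissible clopen upsets. -/
@[ext]
structure StrongMor (X Y : PGPS.{u}) where
  toFun : X → Y
  monotone : Monotone toFun
  preimage_adm : ∀ U, Y.Adm U → X.Adm (toFun ⁻¹' U)

instance : Category PGPSS.{u} where
  Hom X Y := StrongMor X.toPGPS Y.toPGPS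
  id X := ⟨fun x => x, monotone_id, fun _ h => h⟩
  comp f g := ⟨fun x => g.toFun (f.toFun x), g.monotone.comp f.monotone,
    fun U hU => f.preimage_adm _ (g.preimage_adm U hU)⟩

/-- The functor `PGPS_F ⥤ PGPS_S`, `R ↦ (x ↦ min R[x])`. -/
noncomputable def toStrong : PGPSF.{u} ⥤ PGPSS.{u} where
  obj X := ⟨X.obj⟩
  map {X Y} R :=
    { toFun := leastFun R.hom R.property
      monotone := by
        intro x x' hx
        rw [Y.obj.le_iff]
        intro U hU h
        have h1 := box_leastFun R.hom R.property hU.2.1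
        have h2 := (GPMor.box_adm R.hom U hU).2.1
        rw [h1] at h2
        exact h2 hx h
      preimage_adm := by
        intro U hU
        rw [← box_leastFun R.hom R.property hU.2.1]
        exact GPMor.box_adm R.hom U hU }
  map_id X := StrongMor.ext (funext fun x => leastFun_eq _ _ _ _ fun _ => Iff.rfl)
  map_comp {X Y Z} R S := StrongMor.ext (funext fun x => leastFun_eq _ _ _ _
    fun z => comp_rel_iff R.hom S.hom R.property S.property x z)

theorem box_of_fun {X Y : PGPS.{u}} (f : X → Y) {U : Set Y} (hU : IsUpperSet U) :
    box (fun x y => f x ≤ y) U = f ⁻¹' U := by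
  ext x
  exact ⟨fun h => h _ le_rfl, fun h y hy => hU hy h⟩

/-- The functor `PGPS_S ⥤ PGPS_F`, `f ↦ R_f` with `x R_f y` iff `f x ≤ y`. -/
def ofStrong : PGPSS.{u} ⥤ PGPSF.{u} where
  obj X := ⟨X.toPGPS⟩
  map {X Y} f :=
    { hom :=
        { rel := fun x y => f.toFun x ≤ y
          separates := by
            intro x y h
            rw [Y.toPGPS.le_iff] at h
            push Not at h
            obtain ⟨U, hU, hx, hy⟩ := h
            exact ⟨U, hU, fun z hz => hU.2.1 hz hx, hy⟩
          box_adm := by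
            intro U hU
            rw [box_of_fun _ hU.2.1]
            exact f.preimage_adm U hU }
      property := fun x => ⟨f.toFun x, le_rfl, fun _ hz => hz⟩ }
  map_id X := rfl
  map_comp {X Y Z} f g := by
    apply WideSubcategory.hom_ext
    refine GPMor.ext_box fun U hU => ?_
    refine Eq.trans ?_ (GPMor.box_comp _ _ hU).symm
    have h1 := box_of_fun g.toFun hU.2.1
    have h2 := box_of_fun f.toFun (Y := Y.toPGPS) (g.preimage_adm U hU).2.1
    have h3 := box_of_fun (fun x => g.toFun (f.toFun x)) hU.2.1
    refine h3.trans ?_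
    change _ = box (fun x y => f.toFun x ≤ y) (box (fun x y => g.toFun x ≤ y) U)
    rw [h1, h2]
    rfl

/-! ### Algebraic frames -/

/-- Algebraic frames. -/
structure AlgFrmJ : Type (u + 1) where
  carrier : Type u
  [frame : Order.Frame carrier]
  [algebraic : IsCompactlyGenerated carrier]

instance : CoeSort AlgFrmJ.{u} (Type u) := ⟨AlgFrmJ.carrier⟩

attribute [instance] AlgFrmJ.frame AlgFrmJ.algebraic

/-- Maps between algebraic frames that preserve arbitrary joins and compact elements. -/
@[ext]
structure JMor (L M : AlgFrmJ.{u}) where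
  toFun : L → M
  map_sSup : ∀ S : Set L, toFun (sSup S) = sSup (toFun '' S)
  map_compact : ∀ k : L, IsCompactElement k → IsCompactElement (toFun k)

instance : Category AlgFrmJ.{u} where
  Hom := JMor
  id L := ⟨fun a => a, fun S => by simp, fun _ h => h⟩
  comp f g := ⟨fun a => g.toFun (f.toFun a),
    fun S => by rw [f.map_sSup, g.map_sSup, Set.image_image],
    fun k hk => g.map_compact _ (f.map_compact k hk)⟩

/-- Preservation of those nonempty finite meets of compact elements that are compact. -/
def preservesCompactMeets : MorphismProperty AlgFrmJ.{u} :=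
  fun L _ α => ∀ S : Set L, S.Finite → S.Nonempty → (∀ k ∈ S, IsCompactElement k) →
    IsCompactElement (sInf S) → JMor.toFun α (sInf S) = sInf (JMor.toFun α '' S)

instance : preservesCompactMeets.{u}.IsMultiplicative where
  id_mem L := fun S _ _ _ _ => by
    change sInf S = sInf ((fun a => a) '' S)
    simp
  comp_mem α β hα hβ := fun S hS hne hk hI => by
    change β.toFun (α.toFun (sInf S)) = sInf ((fun a => β.toFun (α.toFun a)) '' S)
    have h := hα S hS hne hk hI
    rw [h, hβ _ (hS.image _) (hne.image _), Set.image_image]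
    · rintro _ ⟨k, hkS, rfl⟩
      exact α.map_compact k (hk k hkS)
    · rw [← h]
      exact α.map_compact _ hI

/-- The wide subcategory of `AlgFrmJ` of morphisms that preserve those nonempty finite meets of
compact elements that are compact. -/
abbrev AlgFrmS : Type (u + 1) := WideSubcategory preservesCompactMeets.{u}

theorem JMor.monotone {L M : AlgFrmJ.{u}} (α : JMor L M) : Monotone α.toFun := by
  intro a b hab
  have h := α.map_sSup {a, b}
  rw [sSup_pair, sup_eq_right.2 hab, Set.image_pair, sSup_pair] at h
  rw [h]
  exact le_sup_left

/-- The right adjoint of a join-preserving map. -/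
def JMor.rightAdjoint {L M : AlgFrmJ.{u}} (α : JMor L M) (b : M) : L := sSup {a | α.toFun a ≤ b}

theorem JMor.gc {L M : AlgFrmJ.{u}} (α : JMor L M) :
    GaloisConnection α.toFun α.rightAdjoint := by
  intro a b
  constructor
  · intro h
    exact le_sSup h
  · intro h
    refine (α.monotone h).trans ?_
    unfold JMor.rightAdjoint
    rw [α.map_sSup]
    apply sSup_le
    rintro _ ⟨c, hc, rfl⟩
    exact hc

theorem compact_iff {L : Type u} [CompleteLattice L] (k : L) : IsCompactElement k ↔
    ∀ S : Set L, k ≤ sSup S → ∃ T ⊆ S, T.Finite ∧ k ≤ sSup T := by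
  rw [CompleteLattice.isCompactElement_iff_exists_le_sSup_of_le_sSup]
  refine forall₂_congr fun S _ => ?_
  constructor
  · rintro ⟨t, ht, hk⟩
    exact ⟨t, ht, t.finite_toSet, by rwa [← Finset.sup_id_eq_sSup]⟩
  · rintro ⟨T, hT, hf, hk⟩
    refine ⟨hf.toFinset, by simpa using hT, ?_⟩
    rw [Finset.sup_id_eq_sSup]
    simpa using hk

theorem compact_sSup {L : Type u} [CompleteLattice L] {T : Set L} (hT : T.Finite)
    (h : ∀ k ∈ T, IsCompactElement k) : IsCompactElement (sSup T) := by
  have h1 := CompleteLattice.isCompactElement_finsetSup (f := id) hT.toFinset (by simpa using h)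
  rw [Finset.sup_id_eq_sSup] at h1
  simpa using h1

theorem exists_compact {L : Type u} [CompleteLattice L] [IsCompactlyGenerated L] {a b : L}
    (h : ¬ a ≤ b) : ∃ k, IsCompactElement k ∧ k ≤ a ∧ ¬ k ≤ b := by
  rw [le_iff_compact_le_imp] at h
  push Not at h
  exact h

/-! ### Admissible closed upsets -/

/-- In a compact Priestley space, every point of a closed set is below a maximal one. -/
theorem exists_maximal {X : Type u} [TopologicalSpace X] [PartialOrder X] [CompactSpace X]
    [PriestleySpace X] {C : Set X} (hC : IsClosed C) {x : X} (hx : x ∈ C) :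
    ∃ y, x ≤ y ∧ Maximal (fun z => z ∈ C) y := by
  have hIci : ∀ a : X, IsClosed (Set.Ici a) := by
    intro a
    rw [← isOpen_compl_iff, isOpen_iff_forall_mem_open]
    intro b hb
    obtain ⟨U, hU, hup, ha, hbU⟩ := exists_isClopen_upper_of_not_le hb
    exact ⟨Uᶜ, fun z hz hz' => hz (hup hz' ha), hU.compl.isOpen, hbU⟩
  refine zorn_le_nonempty₀ C ?_ x hx
  intro c hcC hc y hy
  have : Nonempty c := ⟨⟨y, hy⟩⟩
  obtain ⟨z, hz⟩ := IsCompact.nonempty_iInter_of_directed_nonempty_isCompact_isClosed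
    (fun a : c => C ∩ Set.Ici (a : X)) (by
      intro a b
      rcases hc.total a.2 b.2 with h | h
      · exact ⟨b, fun w hw => ⟨hw.1, h.trans hw.2⟩, fun w hw => hw⟩
      · exact ⟨a, fun w hw => hw, fun w hw => ⟨hw.1, h.trans hw.2⟩⟩)
    (fun a => ⟨a, hcC a.2, le_rfl⟩) (fun a => (hC.inter (hIci _)).isCompact)
    (fun a => hC.inter (hIci _))
  rw [Set.mem_iInter] at hz
  exact ⟨z, (hz ⟨y, hy⟩).1, fun a ha => (hz ⟨a, ha⟩).2⟩

theorem admissibleClopen_iff {X : Type u} [TopologicalSpace X] [PartialOrder X] [CompactSpace X]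
    [PriestleySpace X] (X₀ U : Set X) : AdmissibleClopen X₀ U ↔
      IsClopen U ∧ IsUpperSet U ∧ ∀ x ∉ U, ∃ y ∈ X₀, y ∉ U ∧ x ≤ y := by
  refine and_congr_right fun h1 => and_congr_right fun h2 => ?_
  constructor
  · intro h x hx
    obtain ⟨y, hxy, hy⟩ := exists_maximal (C := Uᶜ) h1.compl.isClosed hx
    exact ⟨y, h y hy, hy.1, hxy⟩
  · intro h x hx
    obtain ⟨y, hy, hyU, hxy⟩ := h x hx.1
    rwa [le_antisymm hxy (hx.2 hyU hxy)]

/-- A closed upset `C` is admissible if `X \ C = ↓(X₀ \ C)`. -/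
def PGPS.AdmClosed (X : PGPS.{u}) (C : Set X) : Prop :=
  IsClosed C ∧ IsUpperSet C ∧ Cᶜ = (lowerClosure (X.X₀ \ C) : Set X)

theorem PGPS.admClosed_iff (X : PGPS.{u}) (C : Set X) : X.AdmClosed C ↔
    IsClosed C ∧ IsUpperSet C ∧ ∀ x ∉ C, ∃ y ∈ X.X₀, y ∉ C ∧ x ≤ y := by
  refine and_congr_right fun h1 => and_congr_right fun h2 => ?_
  constructor
  · intro h x hx
    have hx' : x ∈ (lowerClosure (X.X₀ \ C) : Set X) := h ▸ hx
    obtain ⟨y, hy, hxy⟩ := hx'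
    exact ⟨y, hy.1, hy.2, hxy⟩
  · intro h
    ext x
    constructor
    · intro hx
      obtain ⟨y, hy, hyC, hxy⟩ := h x hx
      exact ⟨y, ⟨hy, hyC⟩, hxy⟩
    · rintro ⟨y, hy, hxy⟩ hx
      exact hy.2 (h2 hxy hx)

theorem PGPS.Adm.admClosed {X : PGPS.{u}} {U : Set X} (h : X.Adm U) : X.AdmClosed U := by
  rw [X.admClosed_iff]
  obtain ⟨h1, h2, h3⟩ := (admissibleClopen_iff _ _).1 h
  exact ⟨h1.isClosed, h2, h3⟩

/-- The set `𝒱ᵃ(X)` of admissible closed upsets of `X`. -/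
structure Va (X : PGPS.{u}) : Type u where
  val : Set X
  property : X.AdmClosed val

theorem Va.ext {X : PGPS.{u}} {C D : Va X} (h : C.val = D.val) : C = D := by
  cases C; cases D; cases h; rfl

/-- `𝒱ᵃ(X)` is ordered by reverse inclusion. -/
instance (X : PGPS.{u}) : PartialOrder (Va X) where
  le C D := D.val ⊆ C.val
  le_refl C := fun _ h => h
  le_trans C D E h1 h2 := fun _ h => h1 (h2 h)
  le_antisymm C D h1 h2 := Va.ext (Set.Subset.antisymm h2 h1)

theorem Va.le_def {X : PGPS.{u}} {C D : Va X} : C ≤ D ↔ D.val ⊆ C.val := Iff.rfl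

theorem admClosed_sInter {X : PGPS.{u}} (S : Set (Set X)) (h : ∀ C ∈ S, X.AdmClosed C) :
    X.AdmClosed (⋂₀ S) := by
  rw [X.admClosed_iff]
  refine ⟨isClosed_sInter fun C hC => (h C hC).1, isUpperSet_sInter fun C hC => (h C hC).2.1, ?_⟩
  intro x hx
  simp only [Set.mem_sInter, not_forall] at hx
  obtain ⟨C, hC, hxC⟩ := hx
  obtain ⟨y, hy, hyC, hxy⟩ := ((X.admClosed_iff C).1 (h C hC)).2.2 x hxC
  exact ⟨y, hy, fun h' => hyC (h' C hC), hxy⟩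

/-- Joins in `𝒱ᵃ(X)` are intersections. -/
instance (X : PGPS.{u}) : SupSet (Va X) where
  sSup S := ⟨⋂₀ (Va.val '' S), admClosed_sInter _ (by rintro _ ⟨C, _, rfl⟩; exact C.property)⟩

theorem Va.mem_sSup {X : PGPS.{u}} (S : Set (Va X)) (x : X) :
    x ∈ (sSup S).val ↔ ∀ C ∈ S, x ∈ C.val := by
  change x ∈ ⋂₀ (Va.val '' S) ↔ _
  simp

instance (X : PGPS.{u}) : CompleteLattice (Va X) :=
  completeLatticeOfSup (Va X) fun S => by
    constructor
    · intro C hC x hx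
      exact (Va.mem_sSup S x).1 hx C hC
    · intro D hD x hx
      exact (Va.mem_sSup S x).2 fun C hC => hD hC hx

theorem PGPS.separation {X : PGPS.{u}} {C : Set X} (hC : X.AdmClosed C) {y : X} (hy : y ∉ C) :
    ∃ U, X.Adm U ∧ C ⊆ U ∧ y ∉ U := by
  obtain ⟨z, hz, hzC, hyz⟩ := ((X.admClosed_iff C).1 hC).2.2 y hy
  obtain ⟨hne, hdir⟩ := (X.mem_X₀_iff z).1 hz
  have hU : ∀ x : C, ∃ U, U ∈ missing X.X₀ z ∧ x.1 ∈ U := by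
    intro x
    have hxz : ¬ x.1 ≤ z := fun h => hzC (hC.2.1 h x.2)
    rw [X.le_iff] at hxz
    push Not at hxz
    obtain ⟨U, hU, hx, hzU⟩ := hxz
    exact ⟨U, ⟨hU, hzU⟩, hx⟩
  choose U hU hxU using hU
  obtain ⟨t, ht⟩ := hC.1.isCompact.elim_finite_subcover U (fun x => (hU x).1.1.isOpen)
    (fun x hx => Set.mem_iUnion.2 ⟨⟨x, hx⟩, hxU ⟨x, hx⟩⟩)
  have key : ∃ V ∈ missing X.X₀ z, ∀ i ∈ t, U i ⊆ V := by
    clear ht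
    classical
    induction t using Finset.induction_on with
    | empty => exact ⟨hne.some, hne.some_mem, by simp⟩
    | insert a s _ ih =>
      obtain ⟨V, hV, hs⟩ := ih
      obtain ⟨W, hW, h1, h2⟩ := hdir V hV (U a) (hU a)
      refine ⟨W, hW, fun i hi => ?_⟩
      rcases Finset.mem_insert.1 hi with rfl | hi
      · exact h2
      · exact (hs i hi).trans h1
  obtain ⟨V, hV, hs⟩ := key
  refine ⟨V, hV.1, fun x hx => ?_, fun h => hV.2 (hV.1.2.1 hyz h)⟩
  obtain ⟨i, hi, hxi⟩ := Set.mem_iUnion₂.1 (ht hx)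
  exact hs i hi hxi

theorem Va.mem_inf {X : PGPS.{u}} {A B : Va X} {x : X} (hx : x ∈ X.X₀)
    (h : x ∈ (A ⊓ B).val) : x ∈ A.val ∨ x ∈ B.val := by
  by_contra hn
  push Not at hn
  obtain ⟨U, hU, hAU, hxU⟩ := X.separation A.property hn.1
  obtain ⟨V, hV, hBV, hxV⟩ := X.separation B.property hn.2
  obtain ⟨W, hW, h1, h2⟩ := ((X.mem_X₀_iff x).1 hx).2 U ⟨hU, hxU⟩ V ⟨hV, hxV⟩
  have hle : (⟨W, PGPS.Adm.admClosed hW.1⟩ : Va X) ≤ A ⊓ B :=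
    le_inf (hAU.trans h1) (hBV.trans h2)
  exact hW.2 (hle h)

instance (X : PGPS.{u}) : Order.Frame (Va X) :=
  Order.Frame.ofMinimalAxioms ⟨fun A S => by
    intro x hx
    by_contra hn
    obtain ⟨y, hy, hyn, hxy⟩ := ((X.admClosed_iff _).1 (A ⊓ sSup S).property).2.2 x hn
    have hyA : y ∉ A.val := fun h => hyn ((inf_le_left : A ⊓ sSup S ≤ A) h)
    have hyS : y ∉ (sSup S).val := fun h => hyn ((inf_le_right : A ⊓ sSup S ≤ sSup S) h)
    rw [Va.mem_sSup] at hyS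
    push Not at hyS
    obtain ⟨B, hB, hyB⟩ := hyS
    have h1 : y ∈ (⨆ b ∈ S, A ⊓ b).val := (⨆ b ∈ S, A ⊓ b).property.2.1 hxy hx
    have h2 : y ∈ (A ⊓ B).val := (le_iSup₂_of_le B hB le_rfl : A ⊓ B ≤ ⨆ b ∈ S, A ⊓ b) h1
    rcases Va.mem_inf hy h2 with h | h
    · exact hyA h
    · exact hyB h⟩

theorem Va.eq_sSup {X : PGPS.{u}} (C : Va X) : sSup {D : Va X | X.Adm D.val ∧ D ≤ C} = C := by
  apply le_antisymm
  · exact sSup_le fun D hD => hD.2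
  · intro x hx
    by_contra hn
    obtain ⟨U, hU, hCU, hxU⟩ := X.separation C.property hn
    exact hxU ((Va.mem_sSup _ x).1 hx ⟨U, hU.admClosed⟩ ⟨hU, hCU⟩)

/-- The compact elements of `𝒱ᵃ(X)` are the admissible clopen upsets. -/
theorem Va.compact_iff {X : PGPS.{u}} (C : Va X) : IsCompactElement C ↔ X.Adm C.val := by
  rw [GenPriestley.compact_iff]
  constructor
  · intro h
    obtain ⟨T, hT, hf, hC⟩ := h _ C.eq_sSup.ge
    have hCT : C = sSup T :=
      le_antisymm hC (sSup_le fun D hD => (hT hD).2)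
    refine (admissibleClopen_iff _ _).2 ⟨?_, C.property.2.1, ((X.admClosed_iff _).1 C.property).2.2⟩
    have : C.val = ⋂ D ∈ T, D.val := by
      ext x
      conv_lhs => rw [hCT]
      rw [Va.mem_sSup]
      simp
    rw [this]
    exact hf.isClopen_biInter fun D hD => (hT hD).1.1
  · intro h S hS
    obtain ⟨t, ht⟩ := h.1.compl.isClosed.isCompact.elim_finite_subcover
      (fun D : S => (D.1.val)ᶜ) (fun D => D.1.property.1.isOpen_compl) (by
        intro x hx
        by_contra hn
        refine hx (hS ((Va.mem_sSup S x).2 fun D hD => ?_))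
        by_contra hxD
        exact hn (Set.mem_iUnion.2 ⟨⟨D, hD⟩, hxD⟩))
    refine ⟨Subtype.val '' (t : Set S), ?_, t.finite_toSet.image _, ?_⟩
    · rintro _ ⟨D, _, rfl⟩
      exact D.2
    · intro x hx
      by_contra hn
      obtain ⟨D, hD, hxD⟩ := Set.mem_iUnion₂.1 (ht hn)
      exact hxD ((Va.mem_sSup _ x).1 hx D ⟨D, hD, rfl⟩)

instance (X : PGPS.{u}) : IsCompactlyGenerated (Va X) where
  exists_sSup_eq C := ⟨_, fun D hD => (Va.compact_iff D).2 hD.1, C.eq_sSup⟩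

theorem box_admClosed {X Y : PGPS.{u}} (R : GPMor X Y) {C : Set Y} (hC : Y.AdmClosed C) :
    X.AdmClosed (box R.rel C) := by
  have : box R.rel C = ⋂₀ {V | ∃ U, Y.Adm U ∧ C ⊆ U ∧ V = box R.rel U} := by
    ext x
    constructor
    · rintro hx _ ⟨U, hU, hCU, rfl⟩ y hy
      exact hCU (hx y hy)
    · intro hx y hy
      by_contra hn
      obtain ⟨U, hU, hCU, hyU⟩ := Y.separation hC hn
      exact hyU (hx _ ⟨U, hU, hCU, rfl⟩ y hy)
  rw [this]
  apply admClosed_sInter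
  rintro _ ⟨U, hU, _, rfl⟩
  exact PGPS.Adm.admClosed (R.box_adm U hU)

/-- `□_R` as a map `𝒱ᵃ(Y) → 𝒱ᵃ(X)`. -/
def Va.box {X Y : PGPS.{u}} (R : GPMor X Y) (C : Va Y) : Va X :=
  ⟨GenPriestley.box R.rel C.val, box_admClosed R C.property⟩

theorem box_star_admClosed {X Y Z : PGPS.{u}} (R : GPMor X Y) (S : GPMor Y Z) {C : Set Z}
    (hC : Z.AdmClosed C) : box (R.comp S).rel C = box R.rel (box S.rel C) := by
  ext x
  constructor
  · intro h y hxy t hyt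
    exact h t fun W _ hx => hx y hxy t hyt
  · intro h z hz
    by_contra hn
    obtain ⟨U, hU, hCU, hzU⟩ := Z.separation hC hn
    exact hzU (hz U hU fun y hy t ht => hCU (h y hy t ht))

/-- The contravariant functor `𝒱ᵃ`, `X ↦ 𝒱ᵃ(X)`, `R ↦ □_R`. -/
abbrev functorV : PGPS.{u}ᵒᵖ ⥤ AlgFrmJ.{u} where
  obj X := ⟨Va X.unop⟩
  map {Y X} R :=
    { toFun := Va.box R.unop
      map_sSup := by
        intro S
        apply Va.ext
        ext x
        rw [Va.mem_sSup]
        constructor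
        · rintro hx _ ⟨C, hC, rfl⟩ y hy
          exact (Va.mem_sSup S y).1 (hx y hy) C hC
        · intro hx y hy
          exact (Va.mem_sSup S y).2 fun C hC => hx _ ⟨C, hC, rfl⟩ y hy
      map_compact := by
        intro C hC
        rw [Va.compact_iff] at hC ⊢
        exact GPMor.box_adm R.unop _ hC }
  map_id X := JMor.ext (funext fun C => Va.ext (X.unop.box_le C.property.2.1))
  map_comp {X Y Z} R S := JMor.ext (funext fun C => Va.ext
    (box_star_admClosed S.unop R.unop C.property))

/-! ### MeetPrime and pseudoprime elements -/

/-- The way below relation. -/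
def WayBelow {L : Type u} [CompleteLattice L] (a b : L) : Prop :=
  ∀ S : Set L, b ≤ sSup S → ∃ T ⊆ S, T.Finite ∧ a ≤ sSup T

/-- An element `p ≠ 1` is pseudoprime if `a₁ ∧ ⋯ ∧ aₙ ≪ p` implies `aᵢ ≤ p` for some `i`. -/
def Pseudoprime {L : Type u} [CompleteLattice L] (p : L) : Prop :=
  p ≠ ⊤ ∧ ∀ S : Set L, S.Finite → WayBelow (sInf S) p → ∃ a ∈ S, a ≤ p

/-- MeetPrime elements. -/
def MeetPrime {L : Type u} [CompleteLattice L] (p : L) : Prop :=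
  p ≠ ⊤ ∧ ∀ a b : L, a ⊓ b ≤ p → a ≤ p ∨ b ≤ p

theorem wayBelow_iff {L : Type u} [CompleteLattice L] [IsCompactlyGenerated L] {a b : L} :
    WayBelow a b ↔ ∃ t, IsCompactElement t ∧ a ≤ t ∧ t ≤ b := by
  constructor
  · intro h
    obtain ⟨T, hT, hf, ha⟩ := h {c | IsCompactElement c ∧ c ≤ b} (sSup_compact_le_eq b).ge
    exact ⟨sSup T, compact_sSup hf fun k hk => (hT hk).1, ha, sSup_le fun k hk => (hT hk).2⟩
  · rintro ⟨t, ht, hat, htb⟩ S hS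
    obtain ⟨T, hT, hf, h⟩ := (compact_iff t).1 ht S (htb.trans hS)
    exact ⟨T, hT, hf, hat.trans h⟩

/-- The set `Y_L` of pseudoprime elements together with the top element. -/
def pseudoprimesTop (L : Type u) [CompleteLattice L] : Set L := {p | Pseudoprime p} ∪ {⊤}

/-- The topology on an algebraic lattice generated by the sets `↑k` and `(↑l)ᶜ` for compact
`k`, `l`. -/
abbrev latticeTopology (L : Type u) [CompleteLattice L] : TopologicalSpace L :=
  TopologicalSpace.generateFrom
    ({U | ∃ k, IsCompactElement k ∧ U = Set.Ici k} ∪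
      {U | ∃ l, IsCompactElement l ∧ U = (Set.Ici l)ᶜ})

/-- `Y_L` with the restrictions of the order and of the topology of `L`. -/
def YSp (L : AlgFrmJ.{u}) : Type u := {p : L // p ∈ pseudoprimesTop L}

instance (L : AlgFrmJ.{u}) : PartialOrder (YSp L) := inferInstanceAs (PartialOrder {p // p ∈ pseudoprimesTop L})

instance (L : AlgFrmJ.{u}) : TopologicalSpace (YSp L) :=
  (latticeTopology L).induced Subtype.val

/-- The prime elements of `L`, as a subset of `Y_L`. -/
def YSp.primes (L : AlgFrmJ.{u}) : Set (YSp L) := {p | MeetPrime p.val}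

/-- The trace of `↑a` on `Y_L`. -/
def up {L : AlgFrmJ.{u}} (a : L) : Set (YSp L) := {p | a ≤ p.val}

theorem MeetPrime.sInf_le {L : Type u} [CompleteLattice L] {p : L} (hp : MeetPrime p) {S : Set L}
    (hS : S.Finite) (h : sInf S ≤ p) : ∃ a ∈ S, a ≤ p := by
  induction S, hS using Set.Finite.induction_on with
  | empty => exact absurd (top_le_iff.1 (by simpa using h)) hp.1
  | insert _ _ ih =>
    rw [sInf_insert] at h
    rcases hp.2 _ _ h with h | h
    · exact ⟨_, Set.mem_insert _ _, h⟩
    · obtain ⟨a, ha, h⟩ := ih h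
      exact ⟨a, Set.mem_insert_of_mem _ ha, h⟩

theorem MeetPrime.pseudoprime {L : Type u} [CompleteLattice L] [IsCompactlyGenerated L] {p : L}
    (hp : MeetPrime p) : Pseudoprime p := by
  refine ⟨hp.1, fun S hS h => ?_⟩
  obtain ⟨t, _, h1, h2⟩ := wayBelow_iff.1 h
  exact hp.sInf_le hS (h1.trans h2)

theorem exists_prime {L : AlgFrmJ.{u}} {a b : L} (h : ¬ a ≤ b) :
    ∃ p, MeetPrime p ∧ b ≤ p ∧ ¬ a ≤ p := by
  obtain ⟨k, hk, hka, hkb⟩ := exists_compact h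
  obtain ⟨p, hbp, hp⟩ := zorn_le_nonempty₀ {x : L | ¬ k ≤ x} (by
    intro c hc hchain y hy
    refine ⟨sSup c, fun hle => ?_, fun z hz => le_sSup hz⟩
    obtain ⟨x, hx, hkx⟩ := (CompleteLattice.isCompactElement_iff_le_of_directed_sSup_le _ k).1 hk c
      ⟨y, hy⟩ hchain.directedOn hle
    exact hc hx hkx) b hkb
  have hmax : ∀ x : L, ¬ x ≤ p → k ≤ p ⊔ x := by
    intro x hx
    by_contra hn
    exact hx (le_sup_right.trans (hp.2 hn le_sup_left))
  refine ⟨p, ⟨fun hT => hp.1 (hT ▸ le_top), fun x y hxy => ?_⟩, hbp, fun h' => hp.1 (hka.trans h')⟩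
  by_contra hn
  push Not at hn
  have h1 : k ≤ (p ⊔ x) ⊓ (p ⊔ y) := le_inf (hmax x hn.1) (hmax y hn.2)
  rw [← sup_inf_left, sup_eq_left.2 hxy] at h1
  exact hp.1 h1

theorem exists_prime' {L : AlgFrmJ.{u}} {a b : L} (h : ¬ a ≤ b) :
    ∃ p : YSp L, p ∈ YSp.primes L ∧ b ≤ p.val ∧ ¬ a ≤ p.val := by
  obtain ⟨p, hp, h1, h2⟩ := exists_prime h
  exact ⟨⟨p, Or.inl hp.pseudoprime⟩, hp, h1, h2⟩

theorem isClopen_up {L : AlgFrmJ.{u}} {k : L} (hk : IsCompactElement k) : IsClopen (up k) := by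
  constructor
  · rw [← isOpen_compl_iff]
    exact ⟨(Set.Ici k)ᶜ, TopologicalSpace.isOpen_generateFrom_of_mem (Or.inr ⟨k, hk, rfl⟩), rfl⟩
  · exact ⟨Set.Ici k, TopologicalSpace.isOpen_generateFrom_of_mem (Or.inl ⟨k, hk, rfl⟩), rfl⟩

theorem isUpperSet_up {L : AlgFrmJ.{u}} (a : L) : IsUpperSet (up a) :=
  fun _ _ hpq hp => le_trans (b := _) hp hpq

instance (L : AlgFrmJ.{u}) : PriestleySpace (YSp L) where
  priestley {p q} h := by
    obtain ⟨k, hk, hkp, hkq⟩ := exists_compact (a := p.val) (b := q.val) h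
    exact ⟨up k, isClopen_up hk, isUpperSet_up k, hkp, hkq⟩

theorem YSp.topology_eq (L : AlgFrmJ.{u}) :
    (inferInstance : TopologicalSpace (YSp L)) = TopologicalSpace.generateFrom
      ({U | ∃ k : L, IsCompactElement k ∧ U = up k} ∪
        {U | ∃ k : L, IsCompactElement k ∧ U = (up k)ᶜ}) := by
  change (latticeTopology L).induced Subtype.val = _
  unfold latticeTopology
  rw [induced_generateFrom_eq]
  congr 1
  ext U
  constructor
  · rintro ⟨_, ⟨k, hk, rfl⟩ | ⟨k, hk, rfl⟩, rfl⟩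
    · exact Or.inl ⟨k, hk, rfl⟩
    · exact Or.inr ⟨k, hk, rfl⟩
  · rintro (⟨k, hk, rfl⟩ | ⟨k, hk, rfl⟩)
    · exact ⟨_, Or.inl ⟨k, hk, rfl⟩, rfl⟩
    · exact ⟨_, Or.inr ⟨k, hk, rfl⟩, rfl⟩

instance (L : AlgFrmJ.{u}) : CompactSpace (YSp L) where
  isCompact_univ := by
    rw [isCompact_iff_ultrafilter_le_nhds]
    intro F _
    set K : Set L := {k | IsCompactElement k ∧ up k ∈ F} with hK
    set a : L := sSup K with ha
    have hka : ∀ k : L, IsCompactElement k → (k ≤ a ↔ up k ∈ F) := by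
      intro k hk
      constructor
      · intro h
        obtain ⟨T, hT, hf, hkT⟩ := (compact_iff k).1 hk K h
        have h1 : ⋂ t ∈ T, up t ∈ F := by
          rw [← Ultrafilter.mem_coe, Filter.biInter_mem hf]
          exact fun t ht => (hT ht).2
        refine Filter.mem_of_superset h1 fun p hp => hkT.trans (sSup_le fun t ht => ?_)
        exact Set.mem_iInter₂.1 hp t ht
      · intro h
        exact le_sSup ⟨hk, h⟩
    have haY : a ∈ pseudoprimesTop L := by
      by_contra hn
      have hn' : a ≠ ⊤ ∧ ¬ Pseudoprime a := ⟨fun h => hn (Or.inr h), fun h => hn (Or.inl h)⟩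
      have hn2 : ∃ S : Set L, S.Finite ∧ WayBelow (sInf S) a ∧ ∀ s ∈ S, ¬ s ≤ a := by
        by_contra hc
        push Not at hc
        exact hn'.2 ⟨hn'.1, hc⟩
      obtain ⟨S, hS, hw, hs⟩ := hn2
      obtain ⟨t, ht, hSt, hta⟩ := wayBelow_iff.1 hw
      have hc : ∀ s : S, ∃ k, IsCompactElement k ∧ k ≤ s.1 ∧ ¬ k ≤ a :=
        fun s => exists_compact (hs s.1 s.2)
      choose k hk hks hka' using hc
      have := hS.to_subtype
      have h1 : up t ∩ ⋂ s : S, (up (k s))ᶜ ∈ F := by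
        refine Filter.inter_mem ((hka t ht).1 hta) ?_
        rw [Filter.iInter_mem]
        intro s
        refine Ultrafilter.compl_mem_iff_notMem.2 fun h => hka' s ((hka _ (hk s)).2 h)
      obtain ⟨q, hq1, hq2⟩ := F.neBot.nonempty_of_mem h1
      rw [Set.mem_iInter] at hq2
      have hSne : S.Nonempty := by
        rw [Set.nonempty_iff_ne_empty]
        rintro rfl
        rw [sInf_empty] at hSt
        exact hn'.1 (top_le_iff.1 (hSt.trans hta))
      rcases q.2 with hq | hq
      · obtain ⟨s, hsS, hsq⟩ := hq.2 S hS (wayBelow_iff.2 ⟨t, ht, hSt, hq1⟩)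
        exact hq2 ⟨s, hsS⟩ ((hks ⟨s, hsS⟩).trans hsq)
      · obtain ⟨s, hsS⟩ := hSne
        refine hq2 ⟨s, hsS⟩ ?_
        have : q.val = ⊤ := hq
        change _ ≤ q.val
        rw [this]
        exact le_top
    refine ⟨⟨a, haY⟩, trivial, ?_⟩
    have htop := YSp.topology_eq L
    have hn := @TopologicalSpace.nhds_generateFrom (YSp L)
      ({U | ∃ k : L, IsCompactElement k ∧ U = up k} ∪
        {U | ∃ k : L, IsCompactElement k ∧ U = (up k)ᶜ}) ⟨a, haY⟩
    rw [← htop] at hn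
    refine le_trans ?_ hn.ge
    refine le_iInf₂ fun U hU => Filter.le_principal_iff.2 ?_
    obtain ⟨haU, ⟨k, hk, rfl⟩ | ⟨k, hk, rfl⟩⟩ := hU
    · exact (hka k hk).1 haU
    · exact Ultrafilter.compl_mem_iff_notMem.2 fun h => haU ((hka _ hk).2 h)

/-- The admissible clopen upsets of `Y_L` are the sets `↑k ∩ Y_L` for compact `k`. -/
theorem admissible_Y_iff {L : AlgFrmJ.{u}} (U : Set (YSp L)) :
    AdmissibleClopen (YSp.primes L) U ↔ ∃ k : L, IsCompactElement k ∧ U = up k := by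
  rw [admissibleClopen_iff]
  constructor
  · rintro ⟨hcl, hup, hmax⟩
    have h1 : ∀ p ∈ YSp.primes L, p ∉ U → ∃ k : L, IsCompactElement k ∧ U ⊆ up k ∧ p ∉ up k := by
      intro p hp hpU
      have h2 : ∀ u : U, ∃ k, IsCompactElement k ∧ k ≤ u.1.val ∧ ¬ k ≤ p.val :=
        fun u => exists_compact fun h => hpU (hup (a := u.1) h u.2)
      choose k hk hku hkp using h2
      obtain ⟨t, ht⟩ := hcl.isClosed.isCompact.elim_finite_subcover (fun u : U => up (k u))
        (fun u => (isClopen_up (hk u)).isOpen) (fun u hu => Set.mem_iUnion.2 ⟨⟨u, hu⟩, hku ⟨u, hu⟩⟩)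
      have h3 : ¬ sInf (k '' (t : Set U)) ≤ p.val := by
        intro h
        obtain ⟨_, ⟨u, _, rfl⟩, h⟩ := hp.sInf_le (t.finite_toSet.image k) h
        exact hkp u h
      obtain ⟨l, hl, hlk, hlp⟩ := exists_compact h3
      refine ⟨l, hl, fun u hu => ?_, hlp⟩
      obtain ⟨v, hv, huv⟩ := Set.mem_iUnion₂.1 (ht hu)
      have h4 : sInf (k '' (t : Set U)) ≤ k v := sInf_le (Set.mem_image_of_mem k hv)
      exact hlk.trans (h4.trans huv)
    have h2 : ∀ q : (Uᶜ : Set (YSp L)), ∃ k : L, IsCompactElement k ∧ U ⊆ up k ∧ q.1 ∉ up k := by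
      rintro ⟨q, hq⟩
      obtain ⟨p, hp, hpU, hqp⟩ := hmax q hq
      obtain ⟨k, hk, hUk, hpk⟩ := h1 p hp hpU
      exact ⟨k, hk, hUk, fun h => hpk (isUpperSet_up k hqp h)⟩
    choose k hk hUk hqk using h2
    obtain ⟨t, ht⟩ := hcl.compl.isClosed.isCompact.elim_finite_subcover
      (fun q : (Uᶜ : Set (YSp L)) => (up (k q))ᶜ)
      (fun q => (isClopen_up (hk q)).compl.isOpen)
      (fun q hq => Set.mem_iUnion.2 ⟨⟨q, hq⟩, hqk ⟨q, hq⟩⟩)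
    refine ⟨sSup (k '' (t : Set _)), compact_sSup (t.finite_toSet.image k) ?_, ?_⟩
    · rintro _ ⟨q, _, rfl⟩
      exact hk q
    · ext q
      constructor
      · intro hq
        apply sSup_le
        rintro _ ⟨r, _, rfl⟩
        exact hUk r hq
      · intro hq
        by_contra hn
        obtain ⟨r, hr, hqr⟩ := Set.mem_iUnion₂.1 (ht hn)
        have h3 : k r ≤ sSup (k '' (t : Set _)) := le_sSup (Set.mem_image_of_mem k hr)
        exact hqr (h3.trans hq)
  · rintro ⟨k, hk, rfl⟩
    refine ⟨isClopen_up hk, isUpperSet_up k, fun q hq => ?_⟩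
    obtain ⟨p, hp, h1, h2⟩ := exists_prime' (a := k) (b := q.val) hq
    exact ⟨p, hp, h2, h1⟩

theorem nhds_basis {L : AlgFrmJ.{u}} {q : YSp L} {W : Set (YSp L)} (hW : IsOpen W) (hq : q ∈ W) :
    ∃ k : L, IsCompactElement k ∧ k ≤ q.val ∧ ∃ T : Set L, T.Finite ∧
      (∀ l ∈ T, ¬ l ≤ q.val) ∧ ∀ x : YSp L, k ≤ x.val → (∀ l ∈ T, ¬ l ≤ x.val) → x ∈ W := by
  have hb := TopologicalSpace.isTopologicalBasis_of_subbasis (YSp.topology_eq L)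
  obtain ⟨_, ⟨f, ⟨hf, hfs⟩, rfl⟩, hqf, hfW⟩ := hb.exists_subset_of_mem_open hq hW
  have key : ∃ k : L, IsCompactElement k ∧ k ≤ q.val ∧ ∃ T : Set L, T.Finite ∧
      (∀ l ∈ T, ¬ l ≤ q.val) ∧ ∀ x : YSp L, k ≤ x.val → (∀ l ∈ T, ¬ l ≤ x.val) → x ∈ ⋂₀ f := by
    clear hfW
    induction f, hf using Set.Finite.induction_on with
    | empty => exact ⟨sSup ∅, compact_sSup Set.finite_empty (by simp), by simp, ∅,
        Set.finite_empty, by simp, by simp⟩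
    | @insert U f _ _ ih =>
      have hqf : q ∈ ⋂₀ insert U f := hqf
      rw [Set.sInter_insert] at hqf
      obtain ⟨k, hk, hkq, T, hT, hTq, h⟩ := ih ((Set.subset_insert U f).trans hfs) hqf.2
      rcases hfs (Set.mem_insert U f) with ⟨l, hl, rfl⟩ | ⟨l, hl, rfl⟩
      · refine ⟨sSup {k, l}, compact_sSup (by simp) (by simp [hk, hl]), ?_, T, hT, hTq, ?_⟩
        · rw [sSup_pair]
          exact sup_le hkq hqf.1
        · intro x hx hxT
          rw [sSup_pair] at hx
          rw [Set.sInter_insert]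
          exact ⟨le_sup_right.trans hx, h x (le_sup_left.trans hx) hxT⟩
      · refine ⟨k, hk, hkq, insert l T, hT.insert l, ?_, ?_⟩
        · intro t ht
          rcases Set.mem_insert_iff.1 ht with rfl | ht
          · exact hqf.1
          · exact hTq t ht
        · intro x hx hxT
          rw [Set.sInter_insert]
          exact ⟨hxT l (Set.mem_insert _ _), h x hx fun t ht => hxT t (Set.mem_insert_of_mem _ ht)⟩
  obtain ⟨k, hk, hkq, T, hT, hTq, h⟩ := key
  exact ⟨k, hk, hkq, T, hT, hTq, fun x h1 h2 => hfW (h x h1 h2)⟩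

/-- The pointed generalized Priestley space `⟨Y_L, τ, ≤, P(L), 1⟩`. -/
abbrev YObj (L : AlgFrmJ.{u}) : PGPS.{u} where
  carrier := YSp L
  X₀ := YSp.primes L
  m := ⟨⊤, Or.inr rfl⟩
  le_m p := le_top (a := p.val)
  X₀_subset p hp h := hp.1 (congrArg Subtype.val h)
  dense := by
    intro q hq
    have hqp : Pseudoprime q.val := q.2.resolve_right fun h => hq (Subtype.ext h)
    rw [mem_closure_iff]
    intro W hW hqW
    obtain ⟨k, hk, hkq, T, hT, hTq, h⟩ := nhds_basis hW hqW
    have h1 : ¬ sInf T ≤ k := fun hle => by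
      obtain ⟨l, hl, hlq⟩ := hqp.2 T hT (wayBelow_iff.2 ⟨k, hk, hle, hkq⟩)
      exact hTq l hl hlq
    obtain ⟨p, hp, hkp, hTp⟩ := exists_prime' h1
    exact ⟨p, h p hkp fun l hl hlp => hTp ((sInf_le hl).trans hlp), hp⟩
  order_dense q hq := by
    have h1 : ¬ (⊤ : L) ≤ q.val := fun h => hq (Subtype.ext (top_le_iff.1 h))
    obtain ⟨p, hp, hqp, _⟩ := exists_prime' h1
    exact ⟨p, hp, hqp⟩
  mem_X₀_iff a := by
    constructor
    · intro ha
      constructor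
      · have h1 : ¬ (⊤ : L) ≤ a.val := fun h => ha.1 (top_le_iff.1 h)
        obtain ⟨k, hk, _, hka⟩ := exists_compact h1
        exact ⟨up k, (admissible_Y_iff _).2 ⟨k, hk, rfl⟩, hka⟩
      · rintro U ⟨hU, haU⟩ W ⟨hW, haW⟩
        obtain ⟨k, hk, rfl⟩ := (admissible_Y_iff _).1 hU
        obtain ⟨l, hl, rfl⟩ := (admissible_Y_iff _).1 hW
        have h1 : ¬ k ⊓ l ≤ a.val := fun h => (ha.2 k l h).elim haU haW
        obtain ⟨t, ht, htkl, hta⟩ := exists_compact h1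
        refine ⟨up t, ⟨(admissible_Y_iff _).2 ⟨t, ht, rfl⟩, hta⟩, ?_, ?_⟩
        · exact fun p hp => (htkl.trans inf_le_left).trans hp
        · exact fun p hp => (htkl.trans inf_le_right).trans hp
    · rintro ⟨⟨U, hU, haU⟩, hdir⟩
      refine ⟨fun h => ?_, fun x y hxy => ?_⟩
      · obtain ⟨k, hk, rfl⟩ := (admissible_Y_iff _).1 hU
        exact haU (le_top.trans h.ge)
      · by_contra hn
        push Not at hn
        obtain ⟨k, hk, hkx, hka⟩ := exists_compact hn.1
        obtain ⟨l, hl, hly, hla⟩ := exists_compact hn.2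
        obtain ⟨W, ⟨hW, haW⟩, h1, h2⟩ := hdir (up k) ⟨(admissible_Y_iff _).2 ⟨k, hk, rfl⟩, hka⟩
          (up l) ⟨(admissible_Y_iff _).2 ⟨l, hl, rfl⟩, hla⟩
        obtain ⟨t, ht, rfl⟩ := (admissible_Y_iff _).1 hW
        have h3 : ∀ s : L, up s ⊆ up t → t ≤ s := by
          intro s hs
          by_contra hts
          obtain ⟨p, _, hsp, htp⟩ := exists_prime' hts
          exact htp (hs hsp)
        exact haW (((le_inf (h3 k h1) (h3 l h2)).trans (inf_le_inf hkx hly)).trans hxy)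
  le_iff a b := by
    constructor
    · intro h U hU ha
      exact hU.2.1 h ha
    · intro h
      by_contra hn
      obtain ⟨k, hk, hka, hkb⟩ := exists_compact (a := a.val) (b := b.val) hn
      exact hkb (h (up k) ((admissible_Y_iff _).2 ⟨k, hk, rfl⟩) hka)

/-- The relation `R_α ⊆ Y_M × Y_L`: `p R_α q` iff `r(p) ≤ q`, where `r` is the right adjoint
of `α`. -/
def YRel {L M : AlgFrmJ.{u}} (α : JMor L M) (p : YObj M) (q : YObj L) : Prop :=
  α.rightAdjoint p.val ≤ q.val

theorem box_YRel {L M : AlgFrmJ.{u}} (α : JMor L M) (a : L) :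
    box (YRel α) (up a) = up (α.toFun a) := by
  ext p
  constructor
  · intro h
    by_contra hn
    have h1 : ¬ a ≤ α.rightAdjoint p.val := fun h' => hn ((α.gc a p.val).2 h')
    obtain ⟨q, _, hq1, hq2⟩ := exists_prime' h1
    exact hq2 (h q hq1)
  · intro h q hq
    exact ((α.gc a p.val).1 h).trans hq

/-- `R_α` as a generalized Priestley morphism. -/
def YMap {L M : AlgFrmJ.{u}} (α : JMor L M) : GPMor (YObj M) (YObj L) where
  rel := YRel α
  separates p q h := by
    obtain ⟨k, hk, hkp, hkq⟩ := exists_compact (a := α.rightAdjoint p.val) (b := q.val) h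
    exact ⟨up k, (admissible_Y_iff _).2 ⟨k, hk, rfl⟩, fun z hz => hkp.trans hz, hkq⟩
  box_adm U hU := by
    obtain ⟨k, hk, rfl⟩ := (admissible_Y_iff _).1 hU
    rw [box_YRel]
    exact (admissible_Y_iff _).2 ⟨_, α.map_compact k hk, rfl⟩

/-- The contravariant functor `𝒴`, `L ↦ Y_L`, `α ↦ R_α`. -/
abbrev functorY : AlgFrmJ.{u} ⥤ PGPS.{u}ᵒᵖ where
  obj L := op (YObj L)
  map α := Quiver.Hom.op (V := PGPS.{u}) (YMap α)
  map_id L := by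
    apply Quiver.Hom.unop_inj
    refine GPMor.ext_box fun U hU => ?_
    obtain ⟨k, hk, rfl⟩ := (admissible_Y_iff _).1 hU
    exact (box_YRel _ k).trans ((YObj L).box_le hU.2.1).symm
  map_comp {L M N} α β := by
    apply Quiver.Hom.unop_inj
    refine GPMor.ext_box fun U hU => ?_
    refine Eq.trans ?_ (GPMor.box_comp (YMap β) (YMap α) hU).symm
    obtain ⟨k, hk, rfl⟩ := (admissible_Y_iff _).1 hU
    change box (YRel (α ≫ β)) (up k) = box (YRel β) (box (YRel α) (up k))
    rw [box_YRel, box_YRel, box_YRel]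
    rfl

/-! ### Restrictions of the two functors -/

/-- The restriction `AlgFrm_S ⥤ PGPS_Fᵒᵖ` of `𝒴`, provided that `𝒴` sends morphisms of `AlgFrm_S`
to functional morphisms. -/
def restrictY (h : ∀ (L M : AlgFrmJ.{u}) (α : L ⟶ M), preservesCompactMeets α →
    functional (functorY.map α).unop) : AlgFrmS.{u} ⥤ PGPSF.{u}ᵒᵖ where
  obj L := op ⟨(functorY.obj L.obj).unop⟩
  map {L M} α := Quiver.Hom.op
    (X := (⟨(functorY.obj M.obj).unop⟩ : PGPSF.{u})) (Y := ⟨(functorY.obj L.obj).unop⟩)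
    ⟨(functorY.map α.hom).unop, h L.obj M.obj α.hom α.property⟩
  map_id L := by
    apply Quiver.Hom.unop_inj
    apply WideSubcategory.hom_ext
    exact congrArg Quiver.Hom.unop (functorY.map_id L.obj)
  map_comp α β := by
    apply Quiver.Hom.unop_inj
    apply WideSubcategory.hom_ext
    exact congrArg Quiver.Hom.unop (functorY.map_comp α.hom β.hom)

/-- The restriction `PGPS_Fᵒᵖ ⥤ AlgFrm_S` of `𝒱ᵃ`, provided that `𝒱ᵃ` sends functional morphisms
to morphisms of `AlgFrm_S`. -/
def restrictV (h : ∀ (X Y : PGPS.{u}) (R : X ⟶ Y), functional R →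
    preservesCompactMeets (functorV.map R.op)) : PGPSF.{u}ᵒᵖ ⥤ AlgFrmS.{u} where
  obj X := ⟨functorV.obj (op X.unop.obj)⟩
  map {Y X} R := ⟨functorV.map R.unop.hom.op, h X.unop.obj Y.unop.obj R.unop.hom R.unop.property⟩
  map_id X := WideSubcategory.hom_ext _ (functorV.map_id (op X.unop.obj))
  map_comp R S := WideSubcategory.hom_ext _
    (functorV.map_comp R.unop.hom.op S.unop.hom.op)

/-- The functor `AlgFrm_S ⥤ PGPS_Sᵒᵖ` obtained from the restriction of `𝒴` by replacing a functional
morphism `R` by the map `x ↦ min R[x]`. -/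
noncomputable def strongY (h : ∀ (L M : AlgFrmJ.{u}) (α : L ⟶ M), preservesCompactMeets α →
    functional (functorY.map α).unop) : AlgFrmS.{u} ⥤ PGPSS.{u}ᵒᵖ :=
  restrictY h ⋙ toStrong.op

/-- The functor `PGPS_Sᵒᵖ ⥤ AlgFrm_S` obtained by applying the restriction of `𝒱ᵃ` to the functional
morphisms `R_f`. -/
def strongV (h : ∀ (X Y : PGPS.{u}) (R : X ⟶ Y), functional R →
    preservesCompactMeets (functorV.map R.op)) : PGPSS.{u}ᵒᵖ ⥤ AlgFrmS.{u} :=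
  ofStrong.op ⋙ restrictV h

end GenPriestley

open GenPriestley

/-! Both sides are recovered from compact elements: those of `Va X` are the admissible clopen upsets
of `X`, and the admissible clopen upsets of `Y_L` are the traces `up k` of the compact `k`. A
generalized Priestley morphism is determined by its box on admissible clopen upsets, so naturality
reduces to `box_YRel`: the box of `R_α` sends `up a` to `up (α a)`.

The map `a ↦ up a` is an order embedding because primes separate the elements of an algebraic frame,
and it is onto because an admissible closed upset is the intersection of the admissible clopen
upsets around it.

For `Υ`, the principal upset of a point of `X₀` is prime, since the admissible clopen upsets missing
the point are directed. Density of `X₀` in `X \ {m}` weakens this to pseudoprimeness at the other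
points `x ≠ m` (`principal_mem`), while `m` gives the top. Conversely, compactness produces a
generator for every pseudoprime `C` (`exists_principal_eq`): a point of `C` outside every admissible
clopen upset that does not contain `C`. The resulting order isomorphism matches admissible clopen
upsets, which is all that an isomorphism of spaces requires.

For the restriction, `R_α` is functional once the right adjoint `r` maps `Y_M` into `Y_L`; this is
where compact meets enter (`rightAdjoint_mem`). In the other direction, the box of a functional
relation is the preimage under `x ↦ min R[x]`, and a compact finite nonempty meet in `Va Y` is a
union (`Va.mem_sInf_of_compact`), which preimages preserve. The strong version replaces boxes by
preimages throughout. -/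

namespace GenPriestley

/-! ### Isomorphisms of algebraic frames -/

/-- An order isomorphism as a map preserving joins and compact elements. -/
def JMor.ofOrderIso {L M : AlgFrmJ.{u}} (e : L ≃o M) : JMor L M where
  toFun := e
  map_sSup S := by rw [e.map_sSup, sSup_image]
  map_compact k hk := by
    rw [compact_iff] at hk ⊢
    intro S hS
    obtain ⟨T, hT, hf, h⟩ := hk (e.symm '' S) (by
      rw [sSup_image, ← e.symm.map_sSup]
      exact e.le_symm_apply.2 hS)
    refine ⟨e '' T, ?_, hf.image e, ?_⟩
    · rintro _ ⟨t, ht, rfl⟩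
      obtain ⟨s, hs, rfl⟩ := hT ht
      simpa using hs
    · rw [sSup_image, ← e.map_sSup]
      exact e.monotone h

theorem preservesCompactMeets_ofOrderIso {L M : AlgFrmJ.{u}} (e : L ≃o M) :
    preservesCompactMeets (X := L) (Y := M) (JMor.ofOrderIso e) := by
  intro S _ _ _ _
  change e (sInf S) = sInf (e '' S)
  rw [e.map_sInf, sInf_image]

/-- An order isomorphism as an isomorphism in `AlgFrm_J`. -/
def isoOfOrderIso {L M : AlgFrmJ.{u}} (e : L ≃o M) : L ≅ M where
  hom := JMor.ofOrderIso e
  inv := JMor.ofOrderIso e.symm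
  hom_inv_id := JMor.ext (funext fun a => e.symm_apply_apply a)
  inv_hom_id := JMor.ext (funext fun b => e.apply_symm_apply b)

/-- An order isomorphism as an isomorphism in `AlgFrm_S`. -/
def isoOfOrderIsoS {L M : AlgFrmS.{u}} (e : L.obj ≃o M.obj) : L ≅ M :=
  WideSubcategory.isoMk (isoOfOrderIso e) (preservesCompactMeets_ofOrderIso e)
    (preservesCompactMeets_ofOrderIso e.symm)

/-! ### The unit `η` -/

/-- If `a ≰ b`, some prime lies above `b` but not above `a`; primes belong to `Y_L`, so traces
remember the order of `L`. -/
theorem up_subset_up {L : AlgFrmJ.{u}} {a b : L} : up b ⊆ up a ↔ a ≤ b := by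
  constructor
  · intro h
    by_contra hn
    obtain ⟨p, _, h1, h2⟩ := exists_prime' hn
    exact h2 (h h1)
  · exact fun h p hp => le_trans h hp

theorem up_sSup {L : AlgFrmJ.{u}} (S : Set L) : up (sSup S) = ⋂ a ∈ S, up a := by
  ext p
  simp only [Set.mem_iInter]
  exact sSup_le_iff

/-- Closedness comes from writing `a` as a join of compact elements, and admissibility from
separation by primes. -/
theorem admClosed_up {L : AlgFrmJ.{u}} (a : L) : (YObj L).AdmClosed (up a) := by
  rw [PGPS.admClosed_iff]
  refine ⟨?_, isUpperSet_up a, fun q hq => ?_⟩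
  · rw [← sSup_compact_le_eq a, up_sSup]
    exact isClosed_biInter fun k hk => (isClopen_up hk.1).isClosed
  · obtain ⟨p, hp, h1, h2⟩ := exists_prime' (a := a) (b := q.val) hq
    exact ⟨p, hp, h2, h1⟩

/-- The candidate is the join of all compact `k` with `C ⊆ up k`; its trace is no larger than `C`
because admissible clopen upsets separate `C` from outside points. -/
theorem exists_eq_up {L : AlgFrmJ.{u}} {C : Set (YSp L)} (hC : (YObj L).AdmClosed C) :
    ∃ a : L, up a = C := by
  refine ⟨sSup {k | IsCompactElement k ∧ C ⊆ up k}, ?_⟩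
  rw [up_sSup]
  apply Set.Subset.antisymm
  · intro p hp
    by_contra hn
    obtain ⟨U, hU, hCU, hpU⟩ := PGPS.separation hC hn
    obtain ⟨k, hk, rfl⟩ := (admissible_Y_iff _).1 hU
    exact hpU (Set.mem_iInter₂.1 hp k ⟨hk, hCU⟩)
  · exact Set.subset_iInter₂ fun k hk => hk.2

/-- The order isomorphism `a ↦ ↑a ∩ Y_L` from `L` to `𝒱ᵃ(Y_L)`. -/
noncomputable def etaOrderIso (L : AlgFrmJ.{u}) : L ≃o Va (YObj L) where
  toEquiv := Equiv.ofBijective (fun a => (⟨up a, admClosed_up a⟩ : Va (YObj L))) (by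
    constructor
    · intro a b h
      have h' : up a = up b := congrArg Va.val h
      exact le_antisymm (up_subset_up.1 h'.ge) (up_subset_up.1 h'.le)
    · intro C
      obtain ⟨a, ha⟩ := exists_eq_up C.property
      exact ⟨a, Va.ext ha⟩)
  map_rel_iff' := up_subset_up

theorem up_map_eq_box {L M : AlgFrmJ.{u}} (α : L ⟶ M) (a : L) :
    etaOrderIso M (JMor.toFun α a) = Va.box (YMap α) (etaOrderIso L a) :=
  Va.ext (box_YRel α a).symm

/-! ### The unit `Υ` -/

namespace PGPS

variable (X : PGPS.{u})

theorem isClosed_Ici (x : X) : IsClosed (Set.Ici x) := by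
  rw [← isOpen_compl_iff, isOpen_iff_forall_mem_open]
  intro y hy
  obtain ⟨U, hU, hup, hx, hyU⟩ := exists_isClopen_upper_of_not_le hy
  exact ⟨Uᶜ, fun z hz hz' => hz (hup hz' hx), hU.compl.isOpen, hyU⟩

/-- When `x ≰ y`, an admissible clopen upset contains `x` and misses `y`, and its admissibility
supplies a point of `X₀` above `y` that is still outside. -/
theorem admClosed_Ici (x : X) : X.AdmClosed (Set.Ici x) := by
  rw [X.admClosed_iff]
  refine ⟨X.isClosed_Ici x, isUpperSet_Ici x, fun y hy => ?_⟩
  have hy' : ¬ x ≤ y := hy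
  rw [X.le_iff] at hy'
  push Not at hy'
  obtain ⟨U, hU, hx, hyU⟩ := hy'
  obtain ⟨z, hz, hzU, hyz⟩ := ((admissibleClopen_iff _ _).1 hU).2.2 y hyU
  exact ⟨z, hz, fun h => hzU (hU.2.1 h hx), hyz⟩

/-- The admissible closed upset `↑x`. -/
def principal (x : X) : Va X := ⟨Set.Ici x, X.admClosed_Ici x⟩

variable {X}

/-- The dictionary between order and membership on which the treatment of `Υ` rests. -/
theorem le_principal_iff {C : Va X} {x : X} : C ≤ X.principal x ↔ x ∈ C.val :=
  ⟨fun h => h le_rfl, fun h _ hy => C.property.2.1 hy h⟩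

theorem principal_le_principal {x y : X} : X.principal x ≤ X.principal y ↔ x ≤ y :=
  le_principal_iff

theorem m_mem (C : Va X) : X.m ∈ C.val := by
  by_contra h
  obtain ⟨y, hy, _, hmy⟩ := ((X.admClosed_iff _).1 C.property).2.2 _ h
  exact X.X₀_subset hy (le_antisymm (X.le_m y) hmy)

theorem principal_m : X.principal X.m = ⊤ :=
  top_le_iff.1 (le_principal_iff.2 (m_mem ⊤))

/-- Primeness is the directedness of the admissible clopen upsets missing `y`, in the form of
`Va.mem_inf`. -/
theorem meetPrime_principal {y : X} (hy : y ∈ X.X₀) : MeetPrime (X.principal y) := by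
  refine ⟨fun h => ?_, fun A B h => ?_⟩
  · rw [← principal_m] at h
    exact X.X₀_subset hy (le_antisymm (X.le_m y) (principal_le_principal.1 h.ge))
  · simp only [le_principal_iff] at h ⊢
    exact Va.mem_inf hy h

theorem exists_mem_X₀ {x : X} (hx : x ≠ X.m) {S : Set (Va X)} (hS : S.Finite) {W : Set X}
    (hW : IsOpen W) (hxW : x ∈ W) (h : ∀ C ∈ S, x ∉ C.val) :
    ∃ y ∈ X.X₀, y ∈ W ∧ ∀ C ∈ S, y ∉ C.val := by
  have hO : IsOpen (W ∩ ⋂ C ∈ S, (C.val)ᶜ) :=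
    hW.inter (hS.isOpen_biInter fun C _ => C.property.1.isOpen_compl)
  obtain ⟨y, ⟨hyW, hyS⟩, hy⟩ := mem_closure_iff.1 (X.dense hx) _ hO
    ⟨hxW, Set.mem_iInter₂.2 h⟩
  exact ⟨y, hy, hyW, Set.mem_iInter₂.1 hyS⟩

/-- A point of an open set contained in a finite meet lies in one of the elements. -/
theorem exists_mem_of_subset_sInf {x : X} (hx : x ≠ X.m) {S : Set (Va X)} (hS : S.Finite)
    {W : Set X} (hW : IsOpen W) (hxW : x ∈ W) (hWS : W ⊆ (sInf S).val) :
    ∃ C ∈ S, x ∈ C.val := by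
  by_contra hn
  push Not at hn
  -- Density trades `x` for a nearby point of `X₀` avoiding the same finitely many closed sets;
  -- there the principal upset is prime.
  obtain ⟨y, hy, hyW, hyS⟩ := exists_mem_X₀ hx hS hW hxW hn
  obtain ⟨C, hC, h⟩ := (meetPrime_principal hy).sInf_le hS (le_principal_iff.2 (hWS hyW))
  exact hyS C hC (le_principal_iff.1 h)

/-- A compact element witnessing `⋀S ≪ ↑x` is a clopen neighbourhood of `x` contained in the set
`⋀S`, so `x` lies in a member of `S` by density. -/
theorem principal_mem (x : X) : X.principal x ∈ pseudoprimesTop (Va X) := by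
  by_cases hx : x = X.m
  · exact Or.inr (hx ▸ principal_m)
  refine Or.inl ⟨fun h => ?_, fun S hS h => ?_⟩
  · rw [← principal_m] at h
    exact hx (le_antisymm (X.le_m x) (principal_le_principal.1 h.ge))
  · obtain ⟨t, ht, hSt, htx⟩ := wayBelow_iff.1 h
    obtain ⟨C, hC, hxC⟩ := exists_mem_of_subset_sInf hx hS ((Va.compact_iff t).1 ht).1.isOpen
      (le_principal_iff.1 htx) hSt
    exact ⟨C, hC, le_principal_iff.2 hxC⟩

theorem eq_of_compact_le_iff {C D : Va X} (h : ∀ K : Va X, X.Adm K.val → (K ≤ C ↔ K ≤ D)) :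
    C = D := by
  apply le_antisymm
  · exact le_iff_compact_le_imp.2 fun K hK => (h K ((Va.compact_iff K).1 hK)).1
  · exact le_iff_compact_le_imp.2 fun K hK => (h K ((Va.compact_iff K).1 hK)).2

/-- An admissible clopen upset can be placed between an admissible closed upset and an open set. -/
theorem exists_adm_between {C : Set X} (hC : X.AdmClosed C) {W : Set X} (hW : IsOpen W)
    (hCW : C ⊆ W) : ∃ U, X.Adm U ∧ C ⊆ U ∧ U ⊆ W := by
  -- The complements of the admissible clopen upsets around `C` cover the compact set `Wᶜ`. A finite
  -- subcover gives finitely many such upsets whose join in `Va X`, their intersection, is again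
  -- compact.
  obtain ⟨t, ht⟩ := hW.isClosed_compl.isCompact.elim_finite_subcover
    (fun D : {D : Va X // X.Adm D.val ∧ C ⊆ D.val} => (D.1.val)ᶜ)
    (fun D => D.1.property.1.isOpen_compl) (fun x hx => by
      obtain ⟨U, hU, hCU, hxU⟩ := X.separation hC fun h => hx (hCW h)
      exact Set.mem_iUnion.2 ⟨⟨⟨U, hU.admClosed⟩, hU, hCU⟩, hxU⟩)
  refine ⟨(sSup (Subtype.val '' (t : Set {D : Va X // X.Adm D.val ∧ C ⊆ D.val}))).val, ?_, ?_, ?_⟩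
  · refine (Va.compact_iff _).1 (compact_sSup (t.finite_toSet.image _) ?_)
    rintro _ ⟨D, _, rfl⟩
    exact (Va.compact_iff _).2 D.2.1
  · intro x hx
    rw [Va.mem_sSup]
    rintro _ ⟨D, _, rfl⟩
    exact D.2.2 hx
  · intro x hx
    by_contra hn
    obtain ⟨D, hD, hxD⟩ := Set.mem_iUnion₂.1 (ht hn)
    exact hxD ((Va.mem_sSup _ x).1 hx D ⟨D, hD, rfl⟩)

/-- If no point of `C` avoided every admissible clopen `K` with `K ≰ C`, finitely many such `K`
would cover `C`. An admissible clopen upset between `C` and their union shows that their meet is way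
below `C`, so some `K ≤ C` by pseudoprimeness, a contradiction. -/
theorem exists_principal_eq {C : Va X} (hC : Pseudoprime C) : ∃ x, X.principal x = C := by
  obtain ⟨x, hxC, hx⟩ : (C.val ∩ ⋂ K : {K : Va X // X.Adm K.val ∧ ¬ K ≤ C}, (K.1.val)ᶜ).Nonempty := by
    refine C.property.1.isCompact.inter_iInter_nonempty _
      (fun K => K.2.1.1.compl.isClosed) fun T => ?_
    by_contra hn
    set S : Set (Va X) := Subtype.val '' (T : Set {K : Va X // X.Adm K.val ∧ ¬ K ≤ C})
    have hS : S.Finite := T.finite_toSet.image _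
    have hcov : C.val ⊆ ⋃ K ∈ S, K.val := by
      intro y hy
      by_contra hyn
      simp only [Set.mem_iUnion, not_exists] at hyn
      exact hn ⟨y, hy, Set.mem_iInter₂.2 fun K hK => hyn K.1 ⟨K, hK, rfl⟩⟩
    have hopen : IsOpen (⋃ K ∈ S, K.val) := by
      refine isOpen_biUnion ?_
      rintro _ ⟨K, _, rfl⟩
      exact K.2.1.1.isOpen
    obtain ⟨U, hU, hCU, hUS⟩ := exists_adm_between C.property hopen hcov
    have hle : sInf S ≤ ⟨U, hU.admClosed⟩ := fun y hy => by
      obtain ⟨K, hK, hyK⟩ := Set.mem_iUnion₂.1 (hUS hy)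
      exact (sInf_le hK : sInf S ≤ K) hyK
    obtain ⟨_, ⟨K, _, rfl⟩, hKC⟩ := hC.2 S hS
      (wayBelow_iff.2 ⟨_, (Va.compact_iff _).2 hU, hle, hCU⟩)
    exact K.2.2 hKC
  -- By the choice of `x`, an admissible clopen `K` contains `x` exactly when it contains `C`.
  refine ⟨x, eq_of_compact_le_iff fun K hK => ?_⟩
  rw [le_principal_iff]
  refine ⟨fun h => ?_, fun h => h hxC⟩
  by_contra hn
  exact Set.mem_iInter.1 hx ⟨K, hK, hn⟩ h

end PGPS

/-- The map `x ↦ ↑x` from `X` to the space of `𝒱ᵃ(X)`. -/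
def upsilonFun (X : PGPS.{u}) (x : X) : YSp ⟨Va X⟩ := ⟨X.principal x, PGPS.principal_mem x⟩

theorem upsilonFun_bijective (X : PGPS.{u}) : Function.Bijective (upsilonFun X) := by
  constructor
  · intro x y h
    have h' : X.principal x = X.principal y := congrArg Subtype.val h
    exact le_antisymm (PGPS.principal_le_principal.1 h'.le) (PGPS.principal_le_principal.1 h'.ge)
  · rintro ⟨C, hC | hC⟩
    · obtain ⟨x, hx⟩ := PGPS.exists_principal_eq hC
      exact ⟨x, Subtype.ext hx⟩
    · exact ⟨X.m, Subtype.ext (PGPS.principal_m.trans (Eq.symm hC))⟩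

/-- The order isomorphism `x ↦ ↑x` from `X` to the space of `𝒱ᵃ(X)`. -/
noncomputable def upsilonOrderIso (X : PGPS.{u}) : X ≃o YObj ⟨Va X⟩ where
  toEquiv := Equiv.ofBijective (upsilonFun X) (upsilonFun_bijective X)
  map_rel_iff' := PGPS.principal_le_principal

theorem upsilonFun_preimage_up {X : PGPS.{u}} (C : Va X) :
    upsilonFun X ⁻¹' (up (L := ⟨Va X⟩) C) = C.val := by
  ext x
  exact PGPS.le_principal_iff

/-- Admissible clopen upsets on either side are indexed by the compact elements of `Va X`, and
`upsilonFun` respects the indexing. -/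
theorem admissible_YVa_iff {X : PGPS.{u}} (U : Set (YSp ⟨Va X⟩)) :
    (YObj ⟨Va X⟩).Adm U ↔ X.Adm (upsilonFun X ⁻¹' U) := by
  constructor
  · intro hU
    obtain ⟨K, hK, rfl⟩ := (admissible_Y_iff U).1 hU
    rw [upsilonFun_preimage_up]
    exact (Va.compact_iff _).1 hK
  · intro hU
    refine (admissible_Y_iff U).2 ⟨⟨_, hU.admClosed⟩, (Va.compact_iff _).2 hU, ?_⟩
    apply (upsilonFun_bijective X).2.preimage_injective
    rw [upsilonFun_preimage_up]

/-- An order isomorphism that matches the admissible clopen upsets is an isomorphism in `PGPS_S`. -/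
def strongIsoOfOrderIso {X Y : PGPSS.{u}} (e : X.toPGPS ≃o Y.toPGPS)
    (h : ∀ U, Y.toPGPS.Adm U ↔ X.toPGPS.Adm (e ⁻¹' U)) : X ≅ Y where
  hom := ⟨e, e.monotone, fun U => (h U).1⟩
  inv := ⟨e.symm, e.symm.monotone, fun U hU => (h _).2 (by
    convert hU using 1
    ext x
    simp)⟩
  hom_inv_id := StrongMor.ext (funext e.symm_apply_apply)
  inv_hom_id := StrongMor.ext (funext e.apply_symm_apply)

/-- The isomorphism `x ↦ ↑x` in `PGPS_S`. -/
noncomputable def upsilonS (X : PGPSS.{u}) : X ≅ ⟨YObj ⟨Va X.toPGPS⟩⟩ :=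
  strongIsoOfOrderIso (Y := ⟨YObj ⟨Va X.toPGPS⟩⟩) (upsilonOrderIso X.toPGPS) admissible_YVa_iff

/-- The isomorphism in `PGPS_F` given by the relation `C ⊆ ↑x`. -/
noncomputable def upsilonF (X : PGPSF.{u}) : X ≅ ⟨YObj ⟨Va X.obj⟩⟩ :=
  ofStrong.mapIso (upsilonS ⟨X.obj⟩)

/-- The isomorphism in `PGPS` given by the relation `C ⊆ ↑x`. -/
noncomputable def upsilon (X : PGPS.{u}) : X ≅ YObj ⟨Va X⟩ :=
  (wideSubcategoryInclusion functional).mapIso (upsilonF ⟨X⟩)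

theorem box_upsilon {X : PGPS.{u}} (C : Va X) :
    box (GPMor.rel (upsilon X).hom) (up (L := ⟨Va X⟩) C) = C.val :=
  (box_of_fun (Y := YObj ⟨Va X⟩) (upsilonFun X) (isUpperSet_up (L := ⟨Va X⟩) C)).trans
    (upsilonFun_preimage_up C)

/-- On `up C` with `C` compact, the boxes of both composites reduce to `□_R C`. -/
theorem upsilon_naturality {X Z : PGPS.{u}} (R : X ⟶ Z) :
    R ≫ (upsilon Z).hom = (upsilon X).hom ≫ (functorY.map (functorV.map R.op)).unop := by
  refine GPMor.ext_box fun U hU => ?_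
  refine (GPMor.box_comp R (upsilon Z).hom hU).trans
    (Eq.trans ?_ (GPMor.box_comp (upsilon X).hom (YMap (functorV.map R.op)) hU).symm)
  obtain ⟨C, hC, rfl⟩ := (admissible_Y_iff U).1 hU
  change _ = box _ (box (YRel _) _)
  rw [box_YRel, box_upsilon, box_upsilon]
  rfl

/-! ### The restricted duality -/

/-- The nontrivial half of finite distributivity of joins over meets. -/
theorem sInf_sup_le {L : Type u} [Order.Frame L] {S : Set L} (hS : S.Finite) (f : L → L) (t : L) :
    sInf ((fun s => f s ⊔ t) '' S) ≤ sInf (f '' S) ⊔ t := by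
  induction S, hS using Set.Finite.induction_on with
  | empty => simp
  | @insert a S _ _ ih =>
    rw [Set.image_insert_eq, Set.image_insert_eq, sInf_insert, sInf_insert, sup_inf_right]
    exact inf_le_inf_left _ ih

/-- Let `t` be compact with `⋀S ≤ t ≤ r(p)`, and suppose each `s ∈ S` has a compact `k s ≤ s` not
below `r(p)`. The meet of the `k s` need not be compact, but the `k s ⊔ t` are compact with meet
exactly `t`. So `α` preserves that meet, `α t ≤ p` is compact, and pseudoprimeness of `p` puts some
`α (k s ⊔ t)` below `p`, hence `k s ≤ r(p)`. -/
theorem rightAdjoint_mem {L M : AlgFrmJ.{u}} (α : L ⟶ M) (hα : preservesCompactMeets α)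
    (p : YSp M) : JMor.rightAdjoint α p.val ∈ pseudoprimesTop L := by
  rcases p with ⟨p, hp | hp⟩
  · by_cases hr : JMor.rightAdjoint α p = ⊤
    · exact Or.inr hr
    refine Or.inl ⟨hr, fun S hS hw => ?_⟩
    by_contra hn
    push Not at hn
    obtain ⟨t, ht, hSt, htp⟩ := wayBelow_iff.1 hw
    have hSne : S.Nonempty := by
      rw [Set.nonempty_iff_ne_empty]
      rintro rfl
      rw [sInf_empty] at hSt
      exact hr (top_le_iff.1 (hSt.trans htp))
    -- The choice is made on all of `L`, with the dummy value `⊥` off `S`, so that images of `S`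
    -- under `k` can be formed.
    have hk : ∀ s : L, ∃ k, s ∈ S → IsCompactElement k ∧ k ≤ s ∧ ¬ k ≤ JMor.rightAdjoint α p := by
      intro s
      by_cases hs : s ∈ S
      · obtain ⟨k, hk⟩ := exists_compact (hn s hs)
        exact ⟨k, fun _ => hk⟩
      · exact ⟨⊥, fun h => absurd h hs⟩
    choose k hk using hk
    have hinf : sInf ((fun s => k s ⊔ t) '' S) = t := by
      apply le_antisymm
      · exact (sInf_sup_le hS k t).trans (sup_le ((le_sInf fun s hs =>
          (sInf_le (Set.mem_image_of_mem k hs)).trans (hk s hs).2.1).trans hSt) le_rfl)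
      · refine le_sInf ?_
        rintro _ ⟨s, _, rfl⟩
        exact le_sup_right
    have hcomp : ∀ c ∈ (fun s => k s ⊔ t) '' S, IsCompactElement c := by
      rintro _ ⟨s, hs, rfl⟩
      change IsCompactElement (k s ⊔ t)
      rw [← sSup_pair]
      exact compact_sSup (by simp) (by simp [ht, (hk s hs).1])
    have hmap := hα _ (hS.image _) (hSne.image _) hcomp (hinf.symm ▸ ht)
    rw [hinf] at hmap
    obtain ⟨_, ⟨_, ⟨s, hs, rfl⟩, rfl⟩, h⟩ := hp.2 _ ((hS.image _).image (JMor.toFun α))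
      (wayBelow_iff.2 ⟨_, α.map_compact t ht, hmap.ge, (α.gc t p).2 htp⟩)
    exact (hk s hs).2.2 (le_sup_left.trans ((α.gc _ p).1 h))
  · have hp : p = ⊤ := hp
    subst hp
    exact Or.inr (top_le_iff.1 ((α.gc _ _).1 le_top))

/-- The restriction `Y_M → Y_L` of the right adjoint. -/
def rightAdjointY {L M : AlgFrmJ.{u}} (α : L ⟶ M) (hα : preservesCompactMeets α)
    (p : YSp M) : YSp L := ⟨JMor.rightAdjoint α p.val, rightAdjoint_mem α hα p⟩

theorem functional_functorY_map (L M : AlgFrmJ.{u}) (α : L ⟶ M) (hα : preservesCompactMeets α) :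
    functional (functorY.map α).unop :=
  fun p => ⟨rightAdjointY α hα p, le_rfl (a := JMor.rightAdjoint α p.val), fun _ h => h⟩

/-- A compact meet is clopen, hence an open neighbourhood of each of its points, and the density
argument applies away from `m`. The point `m` lies in every admissible closed upset, which is where
nonemptiness of `S` is needed. -/
theorem Va.mem_sInf_of_compact {X : PGPS.{u}} {S : Set (Va X)} (hS : S.Finite) (hne : S.Nonempty)
    (hc : IsCompactElement (sInf S)) {x : X} : x ∈ (sInf S).val ↔ ∃ C ∈ S, x ∈ C.val := by
  constructor
  · intro hx
    by_cases hxm : x = X.m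
    · obtain ⟨C, hC⟩ := hne
      exact ⟨C, hC, hxm ▸ PGPS.m_mem C⟩
    · exact PGPS.exists_mem_of_subset_sInf hxm hS ((Va.compact_iff _).1 hc).1.isOpen hx
        subset_rfl
  · rintro ⟨C, hC, hx⟩
    exact sInf_le hC hx

theorem preservesCompactMeets_functorV_map (X Y : PGPS.{u}) (R : X ⟶ Y) (hR : functional R) :
    preservesCompactMeets (functorV.map R.op) := by
  intro S hS hne _ hc
  change Va.box R (sInf S) = sInf (Va.box R '' S)
  apply le_antisymm
  · refine le_sInf ?_
    rintro _ ⟨C, hC, rfl⟩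
    exact (functorV.map R.op).monotone (sInf_le hC)
  -- Under reverse inclusion this is a statement about points: the least element of `R[x]` lies in
  -- the union `⋀S`, hence in one member.
  · intro x hx
    have hx' : x ∈ leastFun R hR ⁻¹' (sInf S).val :=
      box_leastFun R hR (sInf S).property.2.1 ▸ hx
    obtain ⟨C, hC, hxC⟩ := (Va.mem_sInf_of_compact hS hne hc).1 hx'
    refine (sInf_le (Set.mem_image_of_mem _ hC) : sInf (Va.box R '' S) ≤ Va.box R C) ?_
    change x ∈ box (GPMor.rel R) C.val
    rw [box_leastFun R hR C.property.2.1]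
    exact hxC

/-! ### Passage to strong Priestley morphisms -/

theorem strongY_map_apply {L M : AlgFrmS.{u}} (α : L ⟶ M) (p : YSp M.obj) :
    (StrongMor.toFun ((strongY functional_functorY_map).map α).unop p : YSp L.obj)
      = rightAdjointY α.hom α.property p :=
  leastFun_eq (functorY.map α.hom).unop _ p (rightAdjointY α.hom α.property p) fun _ => Iff.rfl

theorem strongV_map_apply {X Y : PGPSS.{u}} (f : X ⟶ Y) (C : Va Y.toPGPS) :
    (JMor.toFun ((strongV preservesCompactMeets_functorV_map).map f.op).hom C : Va X.toPGPS).val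
      = StrongMor.toFun f ⁻¹' C.val :=
  box_of_fun (StrongMor.toFun f) C.property.2.1

theorem strong_eta_naturality {L M : AlgFrmS.{u}} (α : L ⟶ M) (a : L.obj) :
    (JMor.toFun ((strongV preservesCompactMeets_functorV_map).map
      ((strongY functional_functorY_map).map α)).hom (etaOrderIso L.obj a) : Va (YObj M.obj)).val
      = up (JMor.toFun α.hom a) := by
  refine (strongV_map_apply ((strongY functional_functorY_map).map α).unop _).trans ?_
  ext p
  change a ≤ (StrongMor.toFun ((strongY functional_functorY_map).map α).unop p : YSp L.obj).val ↔ _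
  rw [strongY_map_apply α p]
  exact (α.hom.gc a p.val).symm

/-- With `r` right adjoint to `f⁻¹`, both sides have the same lower bounds: `C ≤ r(↑x)` iff `f⁻¹ C ≤
↑x` iff `f x ∈ C` iff `C ≤ ↑(f x)`. -/
theorem strong_upsilon_naturality {X Z : PGPSS.{u}} (f : X ⟶ Z) (x : X.toPGPS) :
    (StrongMor.toFun ((strongY functional_functorY_map).map
      ((strongV preservesCompactMeets_functorV_map).map f.op)).unop
        (upsilonFun X.toPGPS x) : YSp ⟨Va Z.toPGPS⟩).val
      = Z.toPGPS.principal (StrongMor.toFun f x) := by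
  refine (congrArg Subtype.val (strongY_map_apply _ _)).trans ?_
  refine eq_of_forall_le_iff fun C => ?_
  refine (JMor.gc ((strongV preservesCompactMeets_functorV_map).map f.op).hom C (X.toPGPS.principal x)).symm.trans ?_
  refine PGPS.le_principal_iff.trans (Iff.trans ?_ PGPS.le_principal_iff.symm)
  rw [strongV_map_apply f C]
  rfl

end GenPriestley

/-! ### The three dualities -/

theorem mainTheorem4 :
    -- `𝒴` and `𝒱ᵃ` form a dual equivalence of `AlgFrm_J` and `PGPS`, with units `η` and `Υ`
    ∃ (η : 𝟭 AlgFrmJ.{u} ≅ functorY ⋙ functorV) (Υ : functorV ⋙ functorY ≅ 𝟭 PGPS.{u}ᵒᵖ),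
      (∀ (L : AlgFrmJ.{u}) (a : L), (JMor.toFun (η.hom.app L) a).val = {p : YSp L | a ≤ p.val}) ∧
      (∀ (X : PGPS.{u}) (x : X) (C : YSp ⟨Va X⟩),
        GPMor.rel (Υ.hom.app (op X)).unop x C ↔ C.val.val ⊆ Set.Ici x) ∧
    -- `𝒴`, `𝒱ᵃ`, `η` and `Υ` restrict to a dual equivalence of `AlgFrm_S` and `PGPS_F`
    ∃ (hY : ∀ (L M : AlgFrmJ.{u}) (α : L ⟶ M), preservesCompactMeets α →
        functional (functorY.map α).unop)
      (hV : ∀ (X Y : PGPS.{u}) (R : X ⟶ Y), functional R →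
        preservesCompactMeets (functorV.map R.op)),
      (∃ (ηF : 𝟭 AlgFrmS.{u} ≅ restrictY hY ⋙ restrictV hV)
        (ΥF : restrictV hV ⋙ restrictY hY ≅ 𝟭 PGPSF.{u}ᵒᵖ),
        (∀ L : AlgFrmS.{u}, (ηF.hom.app L).hom = η.hom.app L.obj) ∧
        (∀ X : PGPSF.{u}, (ΥF.hom.app (op X)).unop.hom = (Υ.hom.app (op X.obj)).unop)) ∧
    -- passing to strong Priestley morphisms they yield a dual equivalence of `AlgFrm_S` and `PGPS_S`
      (∃ (ηS : 𝟭 AlgFrmS.{u} ≅ strongY hY ⋙ strongV hV)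
        (ΥS : strongV hV ⋙ strongY hY ≅ 𝟭 PGPSS.{u}ᵒᵖ),
        (∀ L : AlgFrmS.{u}, (ηS.hom.app L).hom = η.hom.app L.obj) ∧
        (∀ (X : PGPSS.{u}) (x : X.toPGPS),
          ((StrongMor.toFun (ΥS.hom.app (op X)).unop x : YSp ⟨Va X.toPGPS⟩)).val.val
            = Set.Ici x)) ∧
    -- this duality sends `α` to the restriction of its right adjoint, and `f` to `f⁻¹`
      (∀ (L M : AlgFrmS.{u}) (α : L ⟶ M) (p : YSp M.obj),
        (StrongMor.toFun ((strongY hY).map α).unop p : YSp L.obj).val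
          = JMor.rightAdjoint α.hom p.val) ∧
      (∀ (X Y : PGPSS.{u}) (f : X ⟶ Y) (C : Va Y.toPGPS),
        (JMor.toFun ((strongV hV).map f.op).hom C : Va X.toPGPS).val
          = StrongMor.toFun f ⁻¹' C.val) := by
  refine ⟨NatIso.ofComponents (fun L => isoOfOrderIso (M := ⟨Va (YObj L)⟩) (etaOrderIso L))
      fun {L M} α => JMor.ext (funext (up_map_eq_box α)),
    -- In the opposite category the arrow reverses, so the component out of `Y_{Va X}` is the
    -- opposite of `X ⟶ Y_{Va X}`.
    NatIso.ofComponents (fun X => (upsilon X.unop).op)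
      fun {X Z} R => Quiver.Hom.unop_inj (upsilon_naturality R.unop).symm,
    fun L a => rfl, fun X x C => Iff.rfl, functional_functorY_map,
    preservesCompactMeets_functorV_map, ?_, ?_, fun L M α p => ?_, fun X Y f C => ?_⟩
  · exact ⟨NatIso.ofComponents
        (fun L => isoOfOrderIsoS (M := ⟨⟨Va (YObj L.obj)⟩⟩) (etaOrderIso L.obj))
        fun {L M} α => WideSubcategory.hom_ext _ (JMor.ext (funext (up_map_eq_box α.hom))),
      NatIso.ofComponents (fun X => (upsilonF X.unop).op) fun {X Z} R =>
        Quiver.Hom.unop_inj (WideSubcategory.hom_ext _ (upsilon_naturality R.unop.hom).symm),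
      fun L => rfl, fun X => rfl⟩
  · refine ⟨NatIso.ofComponents
        (fun L => isoOfOrderIsoS (M := ⟨⟨Va (YObj L.obj)⟩⟩) (etaOrderIso L.obj))
        fun {L M} α => WideSubcategory.hom_ext _ (JMor.ext (funext fun a => Va.ext ?_)),
      NatIso.ofComponents (fun X => (upsilonS X.unop).op) fun {X Z} f =>
        Quiver.Hom.unop_inj (StrongMor.ext (funext fun x => (Subtype.ext ?_))),
      fun L => rfl, fun X x => rfl⟩
    · exact (strong_eta_naturality α a).symm
    · exact strong_upsilon_naturality f.unop x
  · exact congrArg Subtype.val (strongY_map_apply α p)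
  · exact strongV_map_apply f C
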